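/- Let $\mathcal X$ be an infinite-dimensional separable real Hilbert space, with inner product $\langle\cdot,\cdot\rangle$ and norm $\|\cdot\|$. Let $\mathcal A$ be a self-adjoint positive-definite (possibly unbounded) operator in $\mathcal X$ with bounded inverse $\mathcal A^{-1}$, let $\mathcal C_1$ be a bounded self-adjoint positive-definite operator (not necessarily trace class), and let $\mathcal C_0$ be a self-adjoint positive-definite trace class operator with orthonormal eigenbasis $(\varphi_k)$ and eigenvalues $\kappa_k>0$. Let $n,\tau>0$ and $\lambda=\frac1{n\tau^2}$. For $t\in\mathbb R$ let $X^t$ be the completion of $\mathcal M=\bigcap_{l\ge 0}\mathcal D(\mathcal C_0^{-l})$ under $\|u\|_t=\|\mathcal C_0^{-t/2}u\|$, i.e. the space of formal series $a=\sum_k a_k\varphi_k$ with $\|a\|_t^2=\sum_k\kappa_k^{-t}a_k^2<\infty$. Assume that there are $s_0\in[0,1)$, $\beta,\ell\ge0$ and $c_1,\dots,c_4>0$ such that 1. $\mathcal C_0^s$ is trace class for all $s>s_0$; 2. $2\ell-\beta+1>2s_0$; 3. $\|\mathcal C_1^{-1/2}\mathcal A^{-1}u\|\asymp\|\mathcal C_0^{\ell-\beta/2}u\|$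 for all $u\in X^{\beta-2\ell}$ (two-sided bound with positive constants); 4. $\|\mathcal C_0^{-\rho/2}\mathcal C_1^{1/2}u\|\le c_1\|\mathcal C_0^{(\beta-\rho)/2}u\|$ for all $u\in X^{\rho-\beta}$, $\rho\in[\lceil\beta-s_0-1\rceil,\beta-s_0)$; 5. $\|\mathcal C_0^{s/2}\mathcal C_1^{-1/2}u\|\le c_2\|\mathcal C_0^{(s-\beta)/2}u\|$ for all $u\in X^{\beta-s}$, $s\in(s_0,1]$; 6. $\|\mathcal C_0^{-s/2}\mathcal C_1^{-1/2}\mathcal A^{-1}u\|\le c_3\|\mathcal C_0^{(2\ell-\beta-s)/2}u\|$ for all $u\in X^{s+\beta-2\ell}$, $s\in(s_0,1]$; 7. $\|\mathcal C_0^{\eta/2}\mathcal A^{-1}\mathcal C_1^{-1}u\|\le c_4\|\mathcal C_0^{\eta/2+\ell-\beta}u\|$ for all $u\in X^{2\beta-2\ell-\eta}$, $\eta\in[\beta-2\ell,1]$. Here an estimate on $X^a$ means that the expression on the left is defined and the estimate holds on the dense subspace $\mathcal M$, the operator being then extended to $X^a$ by continuity; $\mathcal A^{-1}\mathcal C_1^{-1}u$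 is understood weakly, $\langle\mathcal A^{-1}\mathcal C_1^{-1}u,v\rangle=\langle\mathcal C_1^{-1/2}u,\mathcal C_1^{-1/2}\mathcal A^{-1}v\rangle$. Let $u\sim\mathcal N(0,\tau^2\mathcal C_0)$ be a random element of $\mathcal X$, let $\xi\sim\mathcal N(0,\mathcal C_1)$ be independent of $u$ (that is, the coefficients $\xi_k=\langle\xi,\varphi_k\rangle$ are centered and jointly Gaussian with covariances $\langle\mathcal C_1\varphi_i,\varphi_j\rangle$), let $y=\mathcal A^{-1}u+n^{-1/2}\xi$ (as a sequence of coefficients), and let the posterior $\mu^y$ be the conditional distribution of $u$ given $y$. Then $\mathcal C_1^{-1/2}\mathcal A^{-1}$ is defined on all of $X^1$, and there is a bounded self-adjoint positive-definite operator $\mathcal C$ on $\mathcal X$, not depending on $y$, with $$\mathcal C^{-1}=n\,\mathcal A^{-1}\mathcal C_1^{-1}\mathcal A^{-1}+\tau^{-2}\mathcal C_0^{-1},$$ where the right-hand side is the weakly defined operator on $X^1$ and $\mathcal D(\mathcal C^{-1})$ consists of those $w\in X^1$ that it maps into $\mathcal X$, such that for almost every $y$ the following hold: $y\in X^{2\beta-2\ell-1}$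 and $r=\mathcal A^{-1}\mathcal C_1^{-1}y$ is a well-defined element of $X^{-1}$; there is exactly one weak solution $m\in X^1$ of $\mathcal B_\lambda m=\mathcal A^{-1}\mathcal C_1^{-1}y$, that is, exactly one $m\in X^1$ with $$\langle\mathcal C_1^{-1/2}\mathcal A^{-1}m,\mathcal C_1^{-1/2}\mathcal A^{-1}v\rangle+\lambda\langle\mathcal C_0^{-1/2}m,\mathcal C_0^{-1/2}v\rangle=\langle r,v\rangle\qquad\text{for all }v\in X^1;$$ and $\mu^y=\mathcal N(m,\mathcal C)$. -/

import Mathlib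

open MeasureTheory ProbabilityTheory Filter Topology
open scoped RealInnerProductSpace

namespace BayesInverse

/-- A bounded operator is self-adjoint and positive-definite. -/
def PositiveDefinite {X : Type*} [NormedAddCommGroup X] [InnerProductSpace ℝ X]
    (T : X →L[ℝ] X) : Prop :=
  (∀ x y : X, ⟪T x, y⟫ = ⟪x, T y⟫) ∧ ∀ x : X, x ≠ 0 → 0 < ⟪T x, x⟫

/-- The operators of the inverse problem `y = A⁻¹ u + n^(-1/2) ξ` on a Hilbert space `X`, together
with an orthonormal eigenbasis of the prior covariance operator. -/
structure Setting (X : Type*) [NormedAddCommGroup X] [InnerProductSpace ℝ X]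
    [CompleteSpace X] where
  /-- the prior covariance operator (up to the factor `τ²`) -/
  C₀ : X →L[ℝ] X
  C₀_posDef : PositiveDefinite C₀
  /-- an orthonormal eigenbasis of `C₀` -/
  φ : HilbertBasis ℕ ℝ X
  /-- the eigenvalues of `C₀` -/
  κ : ℕ → ℝ
  C₀_eigen : ∀ k, C₀ (φ k) = κ k • φ k
  /-- the noise covariance operator -/
  C₁ : X →L[ℝ] X
  C₁_posDef : PositiveDefinite C₁
  /-- the (unique) positive square root of `C₁` -/
  sqrtC₁ : X →L[ℝ] X
  sqrtC₁_pos : sqrtC₁.IsPositive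
  sqrtC₁_sq : ∀ x, sqrtC₁ (sqrtC₁ x) = C₁ x
  /-- the, in general unbounded, self-adjoint and positive-definite operator `A` -/
  A : X →ₗ.[ℝ] X
  A_selfAdjoint : IsSelfAdjoint A
  A_pos : ∀ x : A.domain, x ≠ 0 → 0 < ⟪A x, (x : X)⟫
  /-- the bounded inverse of `A` -/
  Ainv : X →L[ℝ] X
  Ainv_spec : ∀ x z : X, Ainv x = z ↔ ∃ h : z ∈ A.domain, A ⟨z, h⟩ = x

namespace Setting

noncomputable section

variable {X : Type*} [NormedAddCommGroup X] [InnerProductSpace ℝ X] [CompleteSpace X]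
  (S : Setting X)

/-- The coefficients of `x` in the eigenbasis. Through them `X`, and all the spaces `X^t` of the
Hilbert scale, are realized as spaces of real sequences. -/
def coeff (x : X) : ℕ → ℝ := fun k => ⟪S.φ k, x⟫

/-- The Hilbert scale: a sequence `a` belongs to `X^t`, the completion of `smooth` under
`‖C₀^(-t/2) ·‖`, iff `∑ κₖ^(-t) aₖ² < ∞`. -/
def MemScale (t : ℝ) (a : ℕ → ℝ) : Prop :=
  Summable fun k => S.κ k ^ (-t) * a k ^ 2

/-- The norm `‖a‖_t = ‖C₀^(-t/2) a‖` of `X^t` (meaningful for `a` in `X^t`). -/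
def scaleNorm (t : ℝ) (a : ℕ → ℝ) : ℝ :=
  √(∑' k, S.κ k ^ (-t) * a k ^ 2)

/-- The common core `⋂ₗ D(C₀^(-l))` of the Hilbert scale; `D(C₀^(-l)) = X^(2l)`. -/
def smooth : Set X :=
  {u | ∀ l : ℕ, S.MemScale (2 * (l : ℝ)) (S.coeff u)}

/-- The domain of `C₁^(-1/2)`. -/
def domInvSqrtC₁ : Set X := Set.range S.sqrtC₁

/-- The operator `C₁^(-1/2)` (meaningful on its domain `domInvSqrtC₁`). -/
def invSqrtC₁ : X → X := Function.invFun S.sqrtC₁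

/-- The operator `A⁻¹ C₁⁻¹`, defined weakly: for `u` in the domain of `C₁^(-1/2)`, the element
`A⁻¹ C₁⁻¹ u` of the Hilbert scale is given by
`⟪A⁻¹ C₁⁻¹ u, v⟫ = ⟪C₁^(-1/2) u, C₁^(-1/2) A⁻¹ v⟫`, that is, by the following coefficients. For `u`
in the domain of `C₁⁻¹` these are the coefficients of the vector `A⁻¹ (C₁⁻¹ u)` of `X`. -/
def AinvC₁inv (u : X) : ℕ → ℝ :=
  fun k => ⟪S.invSqrtC₁ u, S.invSqrtC₁ (S.Ainv (S.φ k))⟫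

/-- The assumptions on `C₀`, `C₁` and `A⁻¹`, expressing `C₁ ≃ C₀^β` and `A⁻¹ ≃ C₀^ℓ`.
An estimate `‖T u‖_b ≤ c ‖u‖_a` for all `u ∈ X^a` is an estimate on the dense subspace `smooth` of
`X^a`, from which `T` is extended to `X^a` by continuity. That the left-hand side makes sense on
`smooth` (domains, and membership in `X^b`) is part of the estimate. -/
structure Assumptions (s₀ β ℓ c₁ c₂ c₃ c₄ : ℝ) : Prop where
  s₀_nonneg : 0 ≤ s₀
  s₀_lt_one : s₀ < 1
  β_nonneg : 0 ≤ β
  ℓ_nonneg : 0 ≤ ℓ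
  c₁_pos : 0 < c₁
  c₂_pos : 0 < c₂
  c₃_pos : 0 < c₃
  c₄_pos : 0 < c₄
  /-- `C₀^s` is trace class for all `s > s₀` -/
  trace : ∀ s : ℝ, s₀ < s → Summable fun k => S.κ k ^ s
  /-- `Δ > 2 s₀` -/
  delta : 2 * s₀ < 2 * ℓ - β + 1
  /-- `‖C₁^(-1/2) A⁻¹ u‖ ≍ ‖C₀^(ℓ - β/2) u‖` -/
  equiv : (∀ u ∈ S.smooth, S.Ainv u ∈ S.domInvSqrtC₁) ∧
    ∃ c c' : ℝ, 0 < c ∧ 0 < c' ∧ ∀ u ∈ S.smooth,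
      c * ‖S.invSqrtC₁ (S.Ainv u)‖ ≤ S.scaleNorm (β - 2 * ℓ) (S.coeff u) ∧
      S.scaleNorm (β - 2 * ℓ) (S.coeff u) ≤ c' * ‖S.invSqrtC₁ (S.Ainv u)‖
  /-- `‖C₀^(-ρ/2) C₁^(1/2) u‖ ≤ c₁ ‖C₀^((β-ρ)/2) u‖` -/
  sqrtC₁_bound : ∀ ρ : ℝ, (⌈β - s₀ - 1⌉ : ℝ) ≤ ρ → ρ < β - s₀ → ∀ u ∈ S.smooth,
    S.MemScale ρ (S.coeff (S.sqrtC₁ u)) ∧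
    S.scaleNorm ρ (S.coeff (S.sqrtC₁ u)) ≤ c₁ * S.scaleNorm (ρ - β) (S.coeff u)
  /-- `‖C₀^(s/2) C₁^(-1/2) u‖ ≤ c₂ ‖C₀^((s-β)/2) u‖` -/
  invSqrtC₁_bound : (∀ u ∈ S.smooth, u ∈ S.domInvSqrtC₁) ∧
    ∀ s : ℝ, s₀ < s → s ≤ 1 → ∀ u ∈ S.smooth,
      S.scaleNorm (-s) (S.coeff (S.invSqrtC₁ u)) ≤ c₂ * S.scaleNorm (β - s) (S.coeff u)
  /-- `‖C₀^(-s/2) C₁^(-1/2) A⁻¹ u‖ ≤ c₃ ‖C₀^((2ℓ-β-s)/2) u‖` -/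
  invSqrtC₁_Ainv_bound : ∀ s : ℝ, s₀ < s → s ≤ 1 → ∀ u ∈ S.smooth,
    S.MemScale s (S.coeff (S.invSqrtC₁ (S.Ainv u))) ∧
    S.scaleNorm s (S.coeff (S.invSqrtC₁ (S.Ainv u))) ≤
      c₃ * S.scaleNorm (s + β - 2 * ℓ) (S.coeff u)
  /-- `‖C₀^(η/2) A⁻¹ C₁⁻¹ u‖ ≤ c₄ ‖C₀^(η/2+ℓ-β) u‖` -/
  AinvC₁inv_bound : ∀ η : ℝ, β - 2 * ℓ ≤ η → η ≤ 1 → ∀ u ∈ S.smooth,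
    S.MemScale (-η) (S.AinvC₁inv u) ∧
    S.scaleNorm (-η) (S.AinvC₁inv u) ≤ c₄ * S.scaleNorm (2 * β - 2 * ℓ - η) (S.coeff u)

/-- `r = A⁻¹ C₁⁻¹ y` for the extension by continuity of `A⁻¹ C₁⁻¹` from `smooth` to an operator
from `X^a` to `X^(-1)`. -/
def IsAinvC₁inv (a : ℝ) (y r : ℕ → ℝ) : Prop :=
  S.MemScale a y ∧ S.MemScale (-1) r ∧
    ∃ u : ℕ → X, (∀ j, u j ∈ S.smooth) ∧
      Tendsto (fun j => S.scaleNorm a (S.coeff (u j) - y)) atTop (𝓝 0) ∧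
      Tendsto (fun j => S.scaleNorm (-1) (S.AinvC₁inv (u j) - r)) atTop (𝓝 0)

/-- The bilinear form
`B(w, v) = ⟪C₁^(-1/2) A⁻¹ w, C₁^(-1/2) A⁻¹ v⟫ + lam ⟪C₀^(-1/2) w, C₀^(-1/2) v⟫` on `X^1`. -/
def B (lam : ℝ) (w v : X) : ℝ :=
  ⟪S.invSqrtC₁ (S.Ainv w), S.invSqrtC₁ (S.Ainv v)⟫ +
    lam * ∑' k, (S.κ k)⁻¹ * (S.coeff w k * S.coeff v k)

/-- `w ∈ X^1` is a weak solution of `B_lam w = r`, where `r ∈ X^(-1)`. -/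
def IsWeakSolution (lam : ℝ) (r : ℕ → ℝ) (w : X) : Prop :=
  S.MemScale 1 (S.coeff w) ∧
    ∀ v : X, S.MemScale 1 (S.coeff v) → S.B lam w v = ∑' k, r k * S.coeff v k

/-- The element `(n A⁻¹ C₁⁻¹ A⁻¹ + τ⁻² C₀⁻¹) w` of `X^(-1)`, for `w ∈ X^1`. -/
def precision (n τ : ℝ) (w : X) : ℕ → ℝ :=
  fun k => n * S.AinvC₁inv (S.Ainv w) k + (τ ^ 2)⁻¹ * ((S.κ k)⁻¹ * S.coeff w k)

/-- `C⁻¹ = n A⁻¹ C₁⁻¹ A⁻¹ + τ⁻² C₀⁻¹`, as operators in `X`: the domain of `C⁻¹` consists of the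
`w ∈ X^1` which the right-hand side maps into `X`, and there both sides agree. -/
def HasPrecision (n τ : ℝ) (C : X →L[ℝ] X) : Prop :=
  ∀ x w : X, C x = w ↔ S.MemScale 1 (S.coeff w) ∧ S.precision n τ w = S.coeff x

/-- `μ` is the law, on coefficient sequences, of `N(0, C₁)`, where `C₁` need not be trace class:
`ξₖ = ⟪φₖ, ξ⟫` are centered, jointly Gaussian, with covariances `⟪C₁ φᵢ, φⱼ⟫`. -/
def IsNoiseLaw (μ : Measure (ℕ → ℝ)) : Prop :=
  IsGaussian μ ∧ (∀ k, ∫ a, a k ∂μ = 0) ∧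
    ∀ i j, cov[fun a => a i, fun a => a j; μ] = ⟪S.C₁ (S.φ i), S.φ j⟫

/-- The observation `y = A⁻¹ u + n^(-1/2) ξ`, as a coefficient sequence. -/
def data {Ω : Type*} (n : ℝ) (u : Ω → X) (ξ : Ω → ℕ → ℝ) (ω : Ω) : ℕ → ℝ :=
  fun k => S.coeff (S.Ainv (u ω)) k + (√n)⁻¹ * ξ ω k

end

end Setting

/-- `μ` is the Gaussian measure `N(m, C)` on the Hilbert space `X`. -/
def IsGaussianWith {X : Type*} [NormedAddCommGroup X] [InnerProductSpace ℝ X]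
    [MeasurableSpace X] [BorelSpace X] (μ : Measure X) (m : X) (C : X →L[ℝ] X) : Prop :=
  IsGaussian μ ∧ ∫ x, x ∂μ = m ∧ ∀ v w : X, covarianceBilin μ v w = ⟪C v, w⟫

end BayesInverse

/-!
In the whitened coordinates `h = C₀^(-1/2) u`, the forward operator is the bounded operator
`L = C₁^(-1/2) A⁻¹ C₀^(1/2)`, and the weak equation `B_lam m = r` becomes
`(L* L + lam) C₀^(-1/2) m = q` with `q = C₀^(1/2) r`. For `r = A⁻¹ C₁⁻¹ y` the vector `q` is the
sum of the series `∑ yᵢ L* C₁^(-1/2) φᵢ`, which converges because almost every `y` lies in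
`X^(2β - 2ℓ - 1)`.

Put `m = C₀^(1/2) (L* L + lam)⁻¹ q` and `C = n⁻¹ C₀^(1/2) (L* L + lam)⁻¹ C₀^(1/2)`. The identity
`L g = ∑ ⟪L* C₁^(-1/2) φᵢ, g⟫ C₁^(1/2) φᵢ` computes the variance of `⟪v, u - m⟫ + ∑ bᵢ yᵢ`, for
finitely supported `b`, as an almost sure limit of Gaussian variables: it is the sum of `⟪C v, v⟫`
and the variance of `∑ bᵢ yᵢ`. Hence `u - m` is distributed as `N(0, C)` and independent of `y`.
-/

namespace BayesInverse

open ContinuousLinearMap (adjoint)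

/-! ### Hilbert spaces -/

section HilbertSpace

variable {ι E : Type*} [NormedAddCommGroup E]

lemma summable_of_norm_sum_sq_le [CompleteSpace E] {f : ι → E} {g : ι → ℝ} (hg : Summable g)
    {c : ℝ} (h : ∀ F : Finset ι, ‖∑ i ∈ F, f i‖ ^ 2 ≤ c * ∑ i ∈ F, g i) : Summable f := by
  rw [summable_iff_vanishing_norm] at hg ⊢
  intro ε hε
  obtain ⟨s, hs⟩ := hg (ε ^ 2 / (|c| + 1)) (by positivity)
  refine ⟨s, fun t ht => lt_of_pow_lt_pow_left₀ 2 hε.le ?_⟩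
  calc ‖∑ i ∈ t, f i‖ ^ 2 ≤ c * ∑ i ∈ t, g i := h t
    _ ≤ |c| * ‖∑ i ∈ t, g i‖ := by
      rw [Real.norm_eq_abs, ← abs_mul]; exact le_abs_self _
    _ ≤ (|c| + 1) * ‖∑ i ∈ t, g i‖ := by gcongr; linarith
    _ < (|c| + 1) * (ε ^ 2 / (|c| + 1)) := by gcongr; exact hs t ht
    _ = ε ^ 2 := by field_simp

lemma summable_smul_of_summable_sq [NormedSpace ℝ E] [CompleteSpace E] {w a : ι → ℝ} {f : ι → E}
    (hw : ∀ i, 0 < w i) (ha : Summable fun i => w i * a i ^ 2)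
    (hf : Summable fun i => (w i)⁻¹ * ‖f i‖ ^ 2) : Summable fun i => a i • f i := by
  refine Summable.of_norm_bounded (ha.add hf) fun i => ?_
  rw [norm_smul, Real.norm_eq_abs, ← sq_abs (a i)]
  -- `2 |a| ‖f‖ ≤ w a² + w⁻¹ ‖f‖²`
  have hi := hw i
  have : 0 ≤ (w i)⁻¹ * (w i * |a i| - ‖f i‖) ^ 2 := by positivity
  have : (w i)⁻¹ * (w i * |a i| - ‖f i‖) ^ 2 =
      w i * |a i| ^ 2 + (w i)⁻¹ * ‖f i‖ ^ 2 - 2 * (|a i| * ‖f i‖) := by field_simp; ring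
  nlinarith [mul_nonneg (abs_nonneg (a i)) (norm_nonneg (f i))]

variable [InnerProductSpace ℝ E]

-- Bessel's inequality, by duality from the bound on finite combinations.
lemma summable_inner_sq_of_norm_sum_sq_le {f : ι → E} {c : ℝ}
    (h : ∀ (a : ι → ℝ) (F : Finset ι), ‖∑ i ∈ F, a i • f i‖ ^ 2 ≤ c * ∑ i ∈ F, a i ^ 2) (x : E) :
    Summable fun i => ⟪f i, x⟫ ^ 2 := by
  refine summable_of_sum_le (c := |c| * ‖x‖ ^ 2) (fun _ => sq_nonneg _) fun F => ?_
  set s := ∑ i ∈ F, ⟪f i, x⟫ ^ 2 with hs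
  have hs₀ : 0 ≤ s := Finset.sum_nonneg fun _ _ => sq_nonneg _
  have hinner : ⟪∑ i ∈ F, ⟪f i, x⟫ • f i, x⟫ = s := by
    simp only [sum_inner, real_inner_smul_left, hs, sq]
  have hsq : s * s ≤ |c| * ‖x‖ ^ 2 * s :=
    calc s * s ≤ (‖∑ i ∈ F, ⟪f i, x⟫ • f i‖ * ‖x‖) ^ 2 := by
          rw [← sq]
          exact pow_le_pow_left₀ hs₀ (hinner ▸ real_inner_le_norm _ x) 2
      _ = ‖∑ i ∈ F, ⟪f i, x⟫ • f i‖ ^ 2 * ‖x‖ ^ 2 := mul_pow ..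
      _ ≤ (|c| * s) * ‖x‖ ^ 2 := by
          gcongr
          exact (h _ F).trans (mul_le_mul_of_nonneg_right (le_abs_self c) hs₀)
      _ = |c| * ‖x‖ ^ 2 * s := by ring
  rcases hs₀.eq_or_lt with hs₁ | hs₁
  · rw [← hs₁]; positivity
  · exact le_of_mul_le_mul_right hsq hs₁

variable (b : HilbertBasis ι ℝ E)

lemma eq_of_inner_basis_eq {x y : E} (h : ∀ i, ⟪b i, x⟫ = ⟪b i, y⟫) : x = y := by
  apply b.repr.injective
  ext i
  simpa only [b.repr_apply_apply] using h i

lemma inner_basis_basis [DecidableEq ι] (i j : ι) : ⟪b i, b j⟫ = if i = j then (1 : ℝ) else 0 :=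
  orthonormal_iff_ite.1 b.orthonormal i j

lemma hasSum_inner_basis_sq (x : E) : HasSum (fun i => ⟪b i, x⟫ ^ 2) (‖x‖ ^ 2) := by
  simpa only [sq, real_inner_comm x, real_inner_self_eq_norm_mul_norm]
    using b.hasSum_inner_mul_inner x x

lemma hasSum_inner_basis_smul (x : E) : HasSum (fun i => ⟪b i, x⟫ • b i) x := by
  simpa only [b.repr_apply_apply] using b.hasSum_repr x

lemma exists_inner_basis_eq {a : ι → ℝ} (ha : Summable fun i => a i ^ 2) :
    ∃ x : E, ∀ i, ⟪b i, x⟫ = a i := by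
  have ha' : Memℓp a 2 := memℓp_gen (by simpa using ha)
  exact ⟨b.repr.symm ⟨a, ha'⟩, fun i => by simp [← b.repr_apply_apply]⟩

lemma exists_diagonal {a : ι → ℝ} {c : ℝ} (ha : ∀ i, |a i| ≤ c) :
    ∃ D : E →L[ℝ] E, ∀ x i, ⟪b i, D x⟫ = a i * ⟪b i, x⟫ := by
  have ha' : ∀ i, ‖a i • ContinuousLinearMap.id ℝ ℝ‖ ≤ |c| := fun i => by
    simpa [norm_smul] using (ha i).trans (le_abs_self c)
  let D := lp.mapCLM 2 _ (abs_nonneg c) ha'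
  refine ⟨b.repr.symm.toContinuousLinearEquiv ∘L D ∘L b.repr.toContinuousLinearEquiv,
    fun x i => ?_⟩
  simp [D, ← b.repr_apply_apply]

-- The Hilbert–Schmidt norm, with weights in the target, may be computed by rows or by columns.
lemma summable_mul_norm_sq_of_isSymmetric {T : E →L[ℝ] E} (hT : ∀ x y, ⟪T x, y⟫ = ⟪x, T y⟫)
    {w : ι → ℝ} (hw : ∀ i, 0 ≤ w i) (hrow : ∀ j, Summable fun i => w i * ⟪b i, T (b j)⟫ ^ 2)
    (hsum : Summable fun j => ∑' i, w i * ⟪b i, T (b j)⟫ ^ 2) :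
    Summable fun i => w i * ‖T (b i)‖ ^ 2 := by
  have hprod : Summable fun p : ι × ι => w p.2 * ⟪b p.2, T (b p.1)⟫ ^ 2 :=
    (summable_prod_of_nonneg fun p => mul_nonneg (hw _) (sq_nonneg _)).2 ⟨hrow, hsum⟩
  refine hprod.prod_symm.prod.congr fun i => ?_
  rw [← ((hasSum_inner_basis_sq b (T (b i))).mul_left (w i)).tsum_eq]
  refine tsum_congr fun j => ?_
  rw [Prod.fst_swap, Prod.snd_swap, ← hT, real_inner_comm]

end HilbertSpace

/-! ### Probability -/

section Probability

variable {Ω : Type*} [MeasurableSpace Ω] {P : Measure Ω}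

lemma ae_summable_of_summable_integral {f : ℕ → Ω → ℝ} (hf : ∀ k, Integrable (f k) P)
    (hnonneg : ∀ k ω, 0 ≤ f k ω) (hsum : Summable fun k => ∫ ω, f k ω ∂P) :
    ∀ᵐ ω ∂P, Summable fun k => f k ω := by
  have hfin : ∫⁻ ω, ∑' k, ENNReal.ofReal (f k ω) ∂P ≠ ⊤ := by
    rw [lintegral_tsum fun k => (hf k).aemeasurable.ennreal_ofReal]
    simp only [← ofReal_integral_eq_lintegral_ofReal (hf _) (.of_forall (hnonneg _))]
    exact hsum.tsum_ofReal_ne_top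
  filter_upwards [ae_lt_top' (AEMeasurable.tsum
    fun k => (hf k).aemeasurable.ennreal_ofReal) hfin] with ω hω
  exact (ENNReal.summable_toReal hω.ne).congr fun k => ENNReal.toReal_ofReal (hnonneg k ω)

lemma exists_measurable_ae_hasSum {E : Type*} [NormedAddCommGroup E] [SecondCountableTopology E]
    [MeasurableSpace E] [BorelSpace E] [CompleteSpace E] {f : ℕ → Ω → E}
    (hf : ∀ k, Measurable (f k)) (hsum : ∀ᵐ ω ∂P, Summable fun k => f k ω) :
    ∃ g : Ω → E, Measurable g ∧ ∀ᵐ ω ∂P, HasSum (fun k => f k ω) (g ω) := by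
  obtain ⟨g, hg, hlim⟩ := measurable_limit_of_tendsto_metrizable_ae (μ := P) (L := atTop)
    (f := fun N ω => ∑ k ∈ Finset.range N, f k ω) (fun N => by fun_prop)
    (hsum.mono fun ω hω => ⟨_, hω.hasSum.tendsto_sum_nat⟩)
  refine ⟨g, hg, ?_⟩
  filter_upwards [hsum, hlim] with ω hω hlimω
  exact hω.hasSum_iff_tendsto_nat.2 hlimω

lemma memLp_continuousLinear_of_isGaussian {E : Type*} [TopologicalSpace E] [AddCommMonoid E]
    [Module ℝ E] [MeasurableSpace E] [OpensMeasurableSpace E] {μ : Measure E} [IsGaussian μ]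
    (Λ : E →L[ℝ] ℝ) : MemLp Λ 2 μ := by
  suffices MemLp (id ∘ Λ) 2 μ from this
  rw [← memLp_map_measure_iff (by fun_prop) (by fun_prop), IsGaussian.map_eq_gaussianReal Λ]
  exact memLp_id_gaussianReal 2

lemma integral_sq_of_hasLaw_gaussianReal {f : Ω → ℝ} {v : ℝ} (hv : 0 ≤ v)
    (hf : HasLaw f (gaussianReal 0 v.toNNReal) P) :
    Integrable (fun ω => f ω ^ 2) P ∧ ∫ ω, f ω ^ 2 ∂P = v := by
  have hmem : MemLp f 2 P := by
    have := memLp_id_gaussianReal (μ := 0) (v := v.toNNReal) 2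
    rw [← hf.map_eq] at this
    exact (memLp_map_measure_iff (by fun_prop) hf.aemeasurable).1 this
  refine ⟨hmem.integrable_sq, ?_⟩
  have := hf.isProbabilityMeasure
  have hmean : P[f] = 0 := by rw [hf.integral_eq, integral_id_gaussianReal]
  rw [← Real.coe_toNNReal v hv, ← variance_id_gaussianReal (μ := 0), ← hf.variance_eq,
    variance_of_integral_eq_zero hf.aemeasurable hmean]

lemma hasLaw_gaussianReal_of_tendsto [IsProbabilityMeasure P] {f : ℕ → Ω → ℝ} {g : Ω → ℝ}
    {v : ℕ → ℝ} {w : ℝ} (hf : ∀ j, HasLaw (f j) (gaussianReal 0 (v j).toNNReal) P)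
    (hg : AEMeasurable g P) (hfg : ∀ᵐ ω ∂P, Tendsto (fun j => f j ω) atTop (𝓝 (g ω)))
    (hv : Tendsto v atTop (𝓝 w)) : HasLaw g (gaussianReal 0 w.toNNReal) P := by
  refine ⟨hg, ?_⟩
  have := Measure.isProbabilityMeasure_map hg
  refine Measure.ext_of_charFun (funext fun t => ?_)
  have hlaw := ProbabilityMeasure.tendsto_iff_tendsto_charFun.1
    (tendstoInDistribution_of_ae_tendsto (fun j => (hf j).aemeasurable) hg hfg).tendsto t
  refine tendsto_nhds_unique hlaw ?_
  have hcont : Continuous fun s : ℝ => charFun (gaussianReal 0 s.toNNReal) t := by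
    simp only [charFun_gaussianReal]
    fun_prop
  exact ((hcont.tendsto w).comp hv).congr fun j => by simp [← (hf j).map_eq]

lemma exists_linearCombination_eq {ι : Type*} {I : Finset ι} (Λ : StrongDual ℝ (I → ℝ)) :
    ∃ b : ι →₀ ℝ, ∀ a : ι → ℝ, Λ (fun i => a i) = Finsupp.linearCombination ℝ a b := by
  classical
  refine ⟨∑ i : I, Finsupp.single (i : ι) (Λ fun j => if i = j then 1 else 0), fun a => ?_⟩
  simp only [map_sum, Finsupp.linearCombination_single, smul_eq_mul, mul_comm (Λ _)]
  exact Λ.toLinearMap.pi_apply_eq_sum_univ fun i : I => a i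

lemma indepFun_of_charFun_add {E ι : Type*} [NormedAddCommGroup E] [NormedSpace ℝ E]
    [CompleteSpace E] [SecondCountableTopology E] [MeasurableSpace E] [BorelSpace E]
    [IsProbabilityMeasure P] {Z : Ω → E} {Y : Ω → ι → ℝ} (hZ : Measurable Z) (hY : Measurable Y)
    (h : ∀ (Λ : StrongDual ℝ E) (b : ι →₀ ℝ),
      charFun (P.map fun ω => Λ (Z ω) + Finsupp.linearCombination ℝ (Y ω) b) 1 =
        charFun (P.map fun ω => Λ (Z ω)) 1 *
          charFun (P.map fun ω => Finsupp.linearCombination ℝ (Y ω) b) 1) :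
    IndepFun Z Y P := by
  have hYi : ∀ i, Measurable fun ω => Y ω i := fun i => (measurable_pi_apply i).comp hY
  refine IndepFun.indepFun_process (Y := fun i ω => Y ω i) hZ hYi fun I => ?_
  have hYI : Measurable fun ω => fun i : I => Y ω i := measurable_pi_lambda _ fun i => hYi i
  refine (indepFun_iff_charFunDual_prod hZ.aemeasurable hYI.aemeasurable).2 fun Λ => ?_
  obtain ⟨b, hb⟩ := exists_linearCombination_eq (Λ.comp (.inr ℝ E (I → ℝ)))
  have hsplit : ∀ ω, Λ (Z ω, fun i : I => Y ω i) =
      Λ.comp (.inl ℝ E (I → ℝ)) (Z ω) + Finsupp.linearCombination ℝ (Y ω) b := fun ω => by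
    rw [← hb, ContinuousLinearMap.comp_apply, ContinuousLinearMap.comp_apply, ← map_add]
    simp
  simp only [charFunDual_eq_charFun_map_one]
  rw [Measure.map_map (by fun_prop) (by fun_prop), Measure.map_map (by fun_prop) hZ,
    Measure.map_map (by fun_prop) hYI]
  simpa only [Function.comp_def, hsplit, hb] using h (Λ.comp (.inl ℝ E (I → ℝ))) b

lemma condDistrib_ae_eq_map_const_add {β E : Type*} [MeasurableSpace β] [AddCommGroup E]
    [MeasurableSpace E] [MeasurableAdd₂ E] [MeasurableSub₂ E] [StandardBorelSpace E]
    [IsProbabilityMeasure P]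
    {Y : Ω → β} {U : Ω → E} {m : β → E} (hY : Measurable Y) (hU : Measurable U)
    (hm : Measurable m) (hind : IndepFun (fun ω => U ω - m (Y ω)) Y P) :
    ∀ᵐ y ∂(P.map Y), condDistrib U Y P y =
      (P.map fun ω => U ω - m (Y ω)).map fun z => m y + z := by
  have hZ : Measurable fun ω => U ω - m (Y ω) := hU.sub (hm.comp hY)
  set Q := P.map fun ω => U ω - m (Y ω)
  have : IsProbabilityMeasure Q := Measure.isProbabilityMeasure_map hZ.aemeasurable
  have : IsProbabilityMeasure (P.map Y) := Measure.isProbabilityMeasure_map hY.aemeasurable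
  have hshift : Measurable fun p : β × E => m p.1 + p.2 := by fun_prop
  let K : Kernel β E := (Kernel.id ×ₖ Kernel.const β Q).map fun p => m p.1 + p.2
  have : IsFiniteKernel K := by dsimp only [K]; infer_instance
  have hK : ∀ y, K y = Q.map fun z => m y + z := fun y => by
    rw [Kernel.map_apply _ hshift, Kernel.prod_apply, Kernel.id_apply, Kernel.const_apply,
      Measure.dirac_prod, Measure.map_map hshift measurable_prodMk_left]
    rfl
  have hjoint : P.map (fun ω => (Y ω, U ω)) =
      ((P.map Y).prod Q).map fun p => (p.1, m p.1 + p.2) := by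
    rw [← (indepFun_iff_map_prod_eq_prod_map_map hY.aemeasurable hZ.aemeasurable).1 hind.symm,
      Measure.map_map (by fun_prop) (hY.prodMk hZ)]
    congr with ω <;> simp
  have hcomp : P.map (fun ω => (Y ω, U ω)) = P.map Y ⊗ₘ K := by
    have hpair : Measurable fun p : β × E => (p.1, m p.1 + p.2) := by fun_prop
    ext s hs
    rw [hjoint, Measure.map_apply hpair hs, Measure.prod_apply (hpair hs),
      Measure.compProd_apply hs]
    refine lintegral_congr fun y => ?_
    rw [hK, Measure.map_apply (by fun_prop) (measurable_prodMk_left hs)]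
    rfl
  filter_upwards [condDistrib_ae_eq_of_measure_eq_compProd Y hU.aemeasurable hcomp] with y hy
  rw [hy, hK]

end Probability

/-! ### Gaussian measures on Hilbert spaces -/

lemma PositiveDefinite.inner_nonneg {X : Type*} [NormedAddCommGroup X] [InnerProductSpace ℝ X]
    {C : X →L[ℝ] X} (hC : PositiveDefinite C) (v : X) : 0 ≤ ⟪C v, v⟫ := by
  rcases eq_or_ne v 0 with rfl | hv
  · rw [inner_zero_right]
  · exact (hC.2 v hv).le

section GaussianWith

variable {X : Type*} [NormedAddCommGroup X] [InnerProductSpace ℝ X] [CompleteSpace X]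
  [SecondCountableTopology X] [MeasurableSpace X] [BorelSpace X] {μ : Measure X} {C : X →L[ℝ] X}

lemma IsGaussianWith.hasLaw_inner (h : IsGaussianWith μ 0 C) (v : X) :
    HasLaw (fun x => ⟪v, x⟫) (gaussianReal 0 ⟪C v, v⟫.toNNReal) μ := by
  obtain ⟨hμ, hmean, hcov⟩ := h
  refine ⟨by fun_prop, (IsGaussian.map_eq_gaussianReal (innerSL ℝ v)).trans ?_⟩
  have hmean' : ∫ x, innerSL ℝ v x ∂μ = 0 := by
    rw [(innerSL ℝ v).integral_comp_comm IsGaussian.integrable_fun_id, hmean, map_zero]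
  rw [hmean', ← hcov, covarianceBilin_self IsGaussian.memLp_two_id]
  rfl

lemma isGaussianWith_zero_of_hasLaw_inner (hC : PositiveDefinite C)
    (h : ∀ v, HasLaw (fun x => ⟪v, x⟫) (gaussianReal 0 ⟪C v, v⟫.toNNReal) μ) :
    IsGaussianWith μ 0 C := by
  have hμ : IsGaussian μ := isGaussian_of_map_eq_gaussianReal fun Λ => by
    obtain ⟨v, rfl⟩ := (InnerProductSpace.toDual ℝ X).surjective Λ
    exact ⟨_, _, (h v).map_eq⟩
  refine ⟨hμ, ext_inner_left ℝ fun v => ?_, fun v w => ?_⟩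
  · rw [inner_zero_right, ← integral_inner IsGaussian.integrable_fun_id, (h v).integral_eq,
      integral_id_gaussianReal]
  · have hCsymm : ((innerSL ℝ).comp C).toBilinForm.IsSymm :=
      ⟨fun v w => (hC.1 v w).trans (real_inner_comm _ _)⟩
    refine LinearMap.congr_fun₂ (LinearMap.BilinForm.ext_of_isSymm
      (isPosSemidef_covarianceBilin (μ := μ)).isSymm hCsymm fun v => ?_) v w
    change covarianceBilin μ v v = ⟪C v, v⟫
    rw [covarianceBilin_self IsGaussian.memLp_two_id, (h v).variance_eq,
      variance_id_gaussianReal, Real.coe_toNNReal _ (hC.inner_nonneg v)]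

lemma IsGaussianWith.map_const_add (h : IsGaussianWith μ 0 C) (m : X) :
    IsGaussianWith (μ.map fun x => m + x) m C := by
  obtain ⟨hμ, hmean, hcov⟩ := h
  refine ⟨inferInstance, ?_, fun v w => ?_⟩
  · rw [integral_map (by fun_prop) (by fun_prop),
      integral_add (integrable_const _) IsGaussian.integrable_fun_id]
    simp [hmean]
  · rw [covarianceBilin_map_const_add, hcov]

end GaussianWith

/-! ### The Hilbert scale -/

namespace Setting

variable {X : Type*} [NormedAddCommGroup X] [InnerProductSpace ℝ X] [CompleteSpace X]
  {S : Setting X}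

lemma κ_pos (k : ℕ) : 0 < S.κ k := by
  have h := S.C₀_posDef.2 (S.φ k) (S.φ.orthonormal.ne_zero k)
  rwa [S.C₀_eigen, real_inner_smul_left, inner_basis_basis, if_pos rfl, mul_one] at h

lemma κ_le (k : ℕ) : S.κ k ≤ ‖S.C₀‖ := by
  have h := S.C₀.le_opNorm (S.φ k)
  rwa [S.C₀_eigen, norm_smul, S.φ.orthonormal.1 k, mul_one, mul_one,
    Real.norm_of_nonneg (κ_pos k).le] at h

lemma κ_rpow_pos (t : ℝ) (k : ℕ) : 0 < S.κ k ^ t := Real.rpow_pos_of_pos (κ_pos k) t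

lemma κ_rpow_half_mul_sq (t x : ℝ) (k : ℕ) :
    (S.κ k ^ (t / 2) * x) ^ 2 = S.κ k ^ t * x ^ 2 := by
  rw [mul_pow, ← Real.rpow_mul_natCast (κ_pos k).le]
  norm_num

lemma κ_rpow_half_mul_neg (t : ℝ) (k : ℕ) : S.κ k ^ (t / 2) * S.κ k ^ (-t / 2) = 1 := by
  rw [← Real.rpow_add (κ_pos k), neg_div, add_neg_cancel, Real.rpow_zero]

lemma coeff_sub (x y : X) : S.coeff (x - y) = S.coeff x - S.coeff y :=
  funext fun _ => inner_sub_right ..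

variable (S) in
/-- `x = C₀^(-t/2) a`: the vector `x` of `X` corresponds to the element `a` of `X^t` under the
isometry `C₀^(-t/2)` from `X^t` onto `X`. -/
def Represents (t : ℝ) (a : ℕ → ℝ) (x : X) : Prop :=
  ∀ k, ⟪S.φ k, x⟫ = S.κ k ^ (-t / 2) * a k

lemma MemScale.exists_represents {t : ℝ} {a : ℕ → ℝ} (ha : S.MemScale t a) :
    ∃ x, S.Represents t a x :=
  exists_inner_basis_eq S.φ (by simp only [κ_rpow_half_mul_sq]; exact ha)

lemma exists_represents (t : ℝ) (x : X) : ∃ a, S.Represents t a x :=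
  ⟨fun k => S.κ k ^ (t / 2) * ⟪S.φ k, x⟫, fun k => by
    rw [← mul_assoc, mul_comm (_ ^ _), κ_rpow_half_mul_neg, one_mul]⟩

namespace Represents

variable {t : ℝ} {a b : ℕ → ℝ} {x y : X}

lemma hasSum (h : S.Represents t a x) : HasSum (fun k => S.κ k ^ (-t) * a k ^ 2) (‖x‖ ^ 2) := by
  simpa only [h _, κ_rpow_half_mul_sq] using hasSum_inner_basis_sq S.φ x

lemma memScale (h : S.Represents t a x) : S.MemScale t a := h.hasSum.summable

lemma scaleNorm_eq (h : S.Represents t a x) : S.scaleNorm t a = ‖x‖ := by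
  rw [scaleNorm, h.hasSum.tsum_eq, Real.sqrt_sq (norm_nonneg x)]

lemma sub (hx : S.Represents t a x) (hy : S.Represents t b y) :
    S.Represents t (a - b) (x - y) := fun k => by
  rw [inner_sub_right, hx, hy, Pi.sub_apply, mul_sub]

lemma unique (hx : S.Represents t a x) (hy : S.Represents t a y) : x = y :=
  eq_of_inner_basis_eq S.φ fun k => (hx k).trans (hy k).symm

lemma unique_seq (ha : S.Represents t a x) (hb : S.Represents t b x) : a = b :=
  funext fun k => mul_left_cancel₀ (κ_rpow_pos (S := S) _ k).ne' ((ha k).symm.trans (hb k))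

lemma inner_eq_tsum (hx : S.Represents (-t) a x) (hy : S.Represents t b y) :
    ⟪x, y⟫ = ∑' k, a k * b k := by
  rw [← S.φ.tsum_inner_mul_inner]
  refine tsum_congr fun k => ?_
  rw [real_inner_comm, hx, hy, neg_neg]
  linear_combination a k * b k * κ_rpow_half_mul_neg (S := S) t k

end Represents

lemma summable_rpow_mul_of_le {t t' : ℝ} (h : t ≤ t') {b : ℕ → ℝ} (hb : ∀ k, 0 ≤ b k)
    (hs : Summable fun k => S.κ k ^ (-t') * b k) : Summable fun k => S.κ k ^ (-t) * b k := by
  refine Summable.of_nonneg_of_le (fun k => mul_nonneg (κ_rpow_pos _ k).le (hb k)) (fun k => ?_)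
    (hs.mul_left (‖S.C₀‖ ^ (t' - t)))
  rw [← mul_assoc]
  refine mul_le_mul_of_nonneg_right ?_ (hb k)
  calc S.κ k ^ (-t) = S.κ k ^ (t' - t) * S.κ k ^ (-t') := by
        rw [← Real.rpow_add (κ_pos k)]; ring_nf
    _ ≤ ‖S.C₀‖ ^ (t' - t) * S.κ k ^ (-t') :=
        mul_le_mul_of_nonneg_right (Real.rpow_le_rpow (κ_pos k).le (κ_le k) (by linarith))
          (κ_rpow_pos _ k).le

lemma scaleNorm_nonneg (t : ℝ) (a : ℕ → ℝ) : 0 ≤ S.scaleNorm t a := Real.sqrt_nonneg _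

lemma scaleNorm_sq (t : ℝ) (a : ℕ → ℝ) : S.scaleNorm t a ^ 2 = ∑' k, S.κ k ^ (-t) * a k ^ 2 :=
  Real.sq_sqrt (tsum_nonneg fun k => mul_nonneg (κ_rpow_pos _ k).le (sq_nonneg _))

lemma MemScale.of_le {t t' : ℝ} (h : t ≤ t') {a : ℕ → ℝ} (ha : S.MemScale t' a) :
    S.MemScale t a :=
  summable_rpow_mul_of_le h (fun k => sq_nonneg (a k)) ha

lemma scaleNorm_sub_le {t : ℝ} {a b : ℕ → ℝ} (ha : S.MemScale t a) (hb : S.MemScale t b) :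
    S.scaleNorm t (a - b) ≤ S.scaleNorm t a + S.scaleNorm t b := by
  obtain ⟨x, hx⟩ := ha.exists_represents
  obtain ⟨y, hy⟩ := hb.exists_represents
  rw [(hx.sub hy).scaleNorm_eq, hx.scaleNorm_eq, hy.scaleNorm_eq]
  exact norm_sub_le x y

lemma MemScale.sub {t : ℝ} {a b : ℕ → ℝ} (ha : S.MemScale t a) (hb : S.MemScale t b) :
    S.MemScale t (a - b) := by
  obtain ⟨x, hx⟩ := ha.exists_represents
  obtain ⟨y, hy⟩ := hb.exists_represents
  exact (hx.sub hy).memScale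

lemma memScale_of_mem_smooth {u : X} (hu : u ∈ S.smooth) (t : ℝ) : S.MemScale t (S.coeff u) := by
  obtain ⟨l, hl⟩ := exists_nat_ge (t / 2)
  exact (hu l).of_le (by linarith)

lemma sub_mem_smooth {u v : X} (hu : u ∈ S.smooth) (hv : v ∈ S.smooth) : u - v ∈ S.smooth :=
  fun l => coeff_sub u v ▸ (hu l).sub (hv l)

variable (S) in
/-- The finite part `∑ i ∈ F, aᵢ φᵢ` of the formal series `∑ aᵢ φᵢ`, an element of `smooth`. -/
noncomputable def trunc (a : ℕ → ℝ) (F : Finset ℕ) : X := ∑ i ∈ F, a i • S.φ i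

lemma coeff_trunc (a : ℕ → ℝ) (F : Finset ℕ) (k : ℕ) :
    S.coeff (S.trunc a F) k = if k ∈ F then a k else 0 := by
  simp [coeff, trunc, inner_sum, inner_smul_right, inner_basis_basis]

lemma trunc_mem_smooth (a : ℕ → ℝ) (F : Finset ℕ) : S.trunc a F ∈ S.smooth := fun _ =>
  summable_of_ne_finset_zero (s := F) fun k hk => by simp [coeff_trunc, hk]

lemma trunc_singleton (k : ℕ) : S.trunc 1 {k} = S.φ k := by simp [trunc]

lemma basis_mem_smooth (k : ℕ) : S.φ k ∈ S.smooth :=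
  trunc_singleton (S := S) k ▸ trunc_mem_smooth _ _

lemma scaleNorm_trunc_sq (t : ℝ) (a : ℕ → ℝ) (F : Finset ℕ) :
    S.scaleNorm t (S.coeff (S.trunc a F)) ^ 2 = ∑ i ∈ F, S.κ i ^ (-t) * a i ^ 2 := by
  rw [scaleNorm_sq, tsum_eq_sum (s := F) fun k hk => by simp [coeff_trunc, hk]]
  exact Finset.sum_congr rfl fun k hk => by rw [coeff_trunc, if_pos hk]

lemma scaleNorm_basis_sq (t : ℝ) (k : ℕ) : S.scaleNorm t (S.coeff (S.φ k)) ^ 2 = S.κ k ^ (-t) := by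
  rw [← trunc_singleton, scaleNorm_trunc_sq]
  simp

lemma MemScale.tendsto_trunc {t : ℝ} {a : ℕ → ℝ} (ha : S.MemScale t a) :
    Tendsto (fun j => S.scaleNorm t (S.coeff (S.trunc a (Finset.range j)) - a)) atTop (𝓝 0) := by
  obtain ⟨x, hx⟩ := ha.exists_represents
  have htrunc (F : Finset ℕ) :
      S.Represents t (S.coeff (S.trunc a F)) (S.trunc (fun i => ⟪S.φ i, x⟫) F) := fun k => by
    change S.coeff _ k = _
    rw [coeff_trunc, coeff_trunc, hx]
    split_ifs <;> simp
  simp only [((htrunc _).sub hx).scaleNorm_eq]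
  exact tendsto_iff_norm_sub_tendsto_zero.1 (hasSum_inner_basis_smul S.φ x).tendsto_sum_nat

variable {E : Type*} [NormedAddCommGroup E] [NormedSpace ℝ E]

variable (S) in
/-- `T` is linear on `smooth`, with `‖T u‖ ≤ c ‖u‖_t` there, so that it extends by continuity to
`X^t`. Outside `smooth`, nothing is required of `T`. -/
structure IsBoundedOn (t c : ℝ) (T : X → E) : Prop where
  map_sub : ∀ u ∈ S.smooth, ∀ v ∈ S.smooth, T (u - v) = T u - T v
  map_trunc : ∀ a F, T (S.trunc a F) = ∑ i ∈ F, a i • T (S.φ i)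
  bound : ∀ u ∈ S.smooth, ‖T u‖ ≤ c * S.scaleNorm t (S.coeff u)

namespace IsBoundedOn

variable {t c : ℝ} {T : X → E} (hT : S.IsBoundedOn t c T)
include hT

lemma norm_sum_smul_sq_le (a : ℕ → ℝ) (F : Finset ℕ) :
    ‖∑ i ∈ F, a i • T (S.φ i)‖ ^ 2 ≤ c ^ 2 * ∑ i ∈ F, S.κ i ^ (-t) * a i ^ 2 := by
  rw [← hT.map_trunc, ← scaleNorm_trunc_sq, ← mul_pow]
  exact pow_le_pow_left₀ (norm_nonneg _) (hT.bound _ (trunc_mem_smooth a F)) 2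

lemma summable_smul [CompleteSpace E] {a : ℕ → ℝ} (ha : S.MemScale t a) :
    Summable fun i => a i • T (S.φ i) :=
  summable_of_norm_sum_sq_le ha (hT.norm_sum_smul_sq_le a)

lemma tendsto_of_hasSum {y : ℕ → ℝ} {q : E} (hy : S.MemScale t y)
    (hq : HasSum (fun i => y i • T (S.φ i)) q) {u : ℕ → X} (hu : ∀ j, u j ∈ S.smooth)
    (hlim : Tendsto (fun j => S.scaleNorm t (S.coeff (u j) - y)) atTop (𝓝 0)) :
    Tendsto (fun j => T (u j)) atTop (𝓝 q) := by
  let p : ℕ → X := fun j => S.trunc y (Finset.range j)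
  have hp (j : ℕ) : p j ∈ S.smooth := trunc_mem_smooth _ _
  have hTp : Tendsto (fun j => T (p j)) atTop (𝓝 q) :=
    hq.tendsto_sum_nat.congr fun j => (hT.map_trunc _ _).symm
  have hsub : Tendsto (fun j => T (u j) - T (p j)) atTop (𝓝 0) := by
    have hbound : Tendsto (fun j => |c| * (S.scaleNorm t (S.coeff (u j) - y) +
        S.scaleNorm t (S.coeff (p j) - y))) atTop (𝓝 0) := by
      simpa using (hlim.add hy.tendsto_trunc).const_mul |c|
    refine squeeze_zero_norm (fun j => ?_) hbound
    calc ‖T (u j) - T (p j)‖ = ‖T (u j - p j)‖ := by rw [hT.map_sub _ (hu j) _ (hp j)]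
      _ ≤ c * S.scaleNorm t (S.coeff (u j - p j)) := hT.bound _ (sub_mem_smooth (hu j) (hp j))
      _ ≤ |c| * S.scaleNorm t (S.coeff (u j - p j)) :=
        mul_le_mul_of_nonneg_right (le_abs_self c) (scaleNorm_nonneg _ _)
      _ ≤ _ := by
        gcongr
        rw [coeff_sub, ← sub_sub_sub_cancel_right _ _ y]
        exact scaleNorm_sub_le ((memScale_of_mem_smooth (hu j) t).sub hy)
          ((memScale_of_mem_smooth (hp j) t).sub hy)
  simpa using hsub.add hTp

end IsBoundedOn

lemma exists_inner_eq_rpow_half_mul {t : ℝ} (ht : 0 ≤ t) :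
    ∃ D : X →L[ℝ] X, ∀ x k, ⟪S.φ k, D x⟫ = S.κ k ^ (t / 2) * ⟪S.φ k, x⟫ :=
  exists_diagonal S.φ (c := ‖S.C₀‖ ^ (t / 2)) fun k => by
    rw [abs_of_pos (κ_rpow_pos _ k)]
    exact Real.rpow_le_rpow (κ_pos k).le (κ_le k) (by positivity)

variable (S) in
/-- The bounded operator `C₀^(t/2)` on `X`, for `t ≥ 0`; it maps `X` isometrically onto `X^t`. -/
noncomputable def potential {t : ℝ} (ht : 0 ≤ t) : X →L[ℝ] X :=
  (exists_inner_eq_rpow_half_mul (S := S) ht).choose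

section Potential

variable {t : ℝ} {ht : 0 ≤ t}

lemma inner_basis_potential (x : X) (k : ℕ) :
    ⟪S.φ k, S.potential ht x⟫ = S.κ k ^ (t / 2) * ⟪S.φ k, x⟫ :=
  (exists_inner_eq_rpow_half_mul ht).choose_spec x k

lemma represents_potential (x : X) : S.Represents t (S.coeff (S.potential ht x)) x := fun k => by
  rw [coeff, inner_basis_potential, ← mul_assoc, mul_comm (_ ^ _), κ_rpow_half_mul_neg, one_mul]

lemma represents_neg_potential (x : X) : S.Represents (-t) (S.coeff x) (S.potential ht x) :=
  fun k => by rw [inner_basis_potential, neg_neg, coeff]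

lemma Represents.potential_eq {x z : X} (h : S.Represents t (S.coeff z) x) :
    S.potential ht x = z := by
  refine eq_of_inner_basis_eq S.φ fun k => ?_
  rw [inner_basis_potential, h, ← mul_assoc, κ_rpow_half_mul_neg, one_mul, coeff]

variable (ht) in
lemma memScale_coeff_iff {w : X} : S.MemScale t (S.coeff w) ↔ ∃ h, S.potential ht h = w := by
  refine ⟨fun hw => ?_, fun ⟨h, hh⟩ => hh ▸ (represents_potential h).memScale⟩
  obtain ⟨h, hh⟩ := hw.exists_represents
  exact ⟨h, hh.potential_eq⟩

lemma inner_potential_left (x y : X) : ⟪S.potential ht x, y⟫ = ⟪x, S.potential ht y⟫ := by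
  rw [← S.φ.tsum_inner_mul_inner, ← S.φ.tsum_inner_mul_inner]
  refine tsum_congr fun k => ?_
  rw [inner_basis_potential, real_inner_comm (S.φ k), inner_basis_potential, real_inner_comm x]
  ring

lemma potential_basis (k : ℕ) : S.potential ht (S.φ k) = S.κ k ^ (t / 2) • S.φ k := by
  refine eq_of_inner_basis_eq S.φ fun j => ?_
  rw [inner_basis_potential, inner_smul_right, inner_basis_basis]
  split_ifs with h <;> simp [h]

lemma potential_injective : Function.Injective (S.potential ht) := fun x y h =>
  (represents_potential x).unique (h ▸ represents_potential y)

end Potential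

variable (S) in
/-- The operator `C₀^(1/2)`. -/
noncomputable abbrev sqrtC₀ : X →L[ℝ] X := S.potential zero_le_one

lemma sqrtC₀_sqrtC₀ (x : X) : S.sqrtC₀ (S.sqrtC₀ x) = S.C₀ x := by
  refine eq_of_inner_basis_eq S.φ fun k => ?_
  rw [inner_basis_potential, inner_basis_potential, ← mul_assoc, ← Real.rpow_add (κ_pos k),
    add_halves, Real.rpow_one, ← S.C₀_posDef.1, S.C₀_eigen, real_inner_smul_left]

lemma inner_C₀_self (x : X) : ⟪S.C₀ x, x⟫ = ‖S.sqrtC₀ x‖ ^ 2 := by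
  rw [← sqrtC₀_sqrtC₀, inner_potential_left, real_inner_self_eq_norm_sq]

end Setting

/-! ### The whitened forward operator -/

section Tikhonov

variable {X Y : Type*} [NormedAddCommGroup X] [InnerProductSpace ℝ X] [CompleteSpace X]
  [NormedAddCommGroup Y] [InnerProductSpace ℝ Y] [CompleteSpace Y]

/-- The normal operator `L* L + lam` of the Tikhonov-regularized least squares problem for `L`. -/
noncomputable def tikhonov (L : X →L[ℝ] Y) (lam : ℝ) : X →L[ℝ] X := adjoint L ∘L L + lam • 1

/-- The resolvent `(L* L + lam)⁻¹`, with the junk value `0` if the inverse does not exist, which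
may happen only for `lam ≤ 0`. -/
noncomputable def tikhonovInv (L : X →L[ℝ] Y) (lam : ℝ) : X →L[ℝ] X :=
  Ring.inverse (tikhonov L lam)

variable (L : X →L[ℝ] Y) {lam : ℝ}

lemma tikhonov_apply (lam : ℝ) (x : X) : tikhonov L lam x = adjoint L (L x) + lam • x := rfl

lemma inner_tikhonov_left (lam : ℝ) (x y : X) :
    ⟪tikhonov L lam x, y⟫ = ⟪L x, L y⟫ + lam * ⟪x, y⟫ := by
  rw [tikhonov_apply, inner_add_left, ContinuousLinearMap.adjoint_inner_left, real_inner_smul_left]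

lemma isUnit_tikhonov (hlam : 0 < lam) : IsUnit (tikhonov L lam) := by
  refine ContinuousLinearMap.isUnit_of_forall_le_norm_inner_map _ (c := ⟨lam, hlam.le⟩) hlam
    fun x => le_trans ?_ (le_abs_self _)
  rw [inner_tikhonov_left, real_inner_self_eq_norm_sq, real_inner_self_eq_norm_sq]
  change ‖x‖ ^ 2 * lam ≤ _
  nlinarith [sq_nonneg ‖L x‖]

lemma tikhonov_tikhonovInv (hlam : 0 < lam) (x : X) : tikhonov L lam (tikhonovInv L lam x) = x :=
  DFunLike.congr_fun (Ring.mul_inverse_cancel _ (isUnit_tikhonov L hlam)) x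

lemma tikhonovInv_tikhonov (hlam : 0 < lam) (x : X) : tikhonovInv L lam (tikhonov L lam x) = x :=
  DFunLike.congr_fun (Ring.inverse_mul_cancel _ (isUnit_tikhonov L hlam)) x

lemma inner_tikhonovInv_left (hlam : 0 < lam) (x y : X) :
    ⟪tikhonovInv L lam x, y⟫ =
      ⟪L (tikhonovInv L lam x), L (tikhonovInv L lam y)⟫ +
        lam * ⟪tikhonovInv L lam x, tikhonovInv L lam y⟫ := by
  nth_rw 1 [← tikhonov_tikhonovInv L hlam y]
  rw [real_inner_comm, inner_tikhonov_left, real_inner_comm, real_inner_comm (tikhonovInv L lam x)]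

lemma posDef_tikhonovInv (hlam : 0 < lam) : PositiveDefinite (tikhonovInv L lam) := by
  refine ⟨fun x y => ?_, fun x hx => ?_⟩
  · rw [inner_tikhonovInv_left L hlam, real_inner_comm _ x, inner_tikhonovInv_left L hlam y,
      real_inner_comm, real_inner_comm (tikhonovInv L lam x)]
  · have hne : tikhonovInv L lam x ≠ 0 := fun h => hx (by
      rw [← tikhonov_tikhonovInv L hlam x, h, map_zero])
    rw [inner_tikhonovInv_left L hlam, real_inner_self_eq_norm_sq, real_inner_self_eq_norm_sq]
    have := norm_pos_iff.2 hne
    positivity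

end Tikhonov

namespace Setting

variable {X : Type*} [NormedAddCommGroup X] [InnerProductSpace ℝ X] [CompleteSpace X]
  {S : Setting X} {s₀ β ℓ c₁ c₂ c₃ c₄ : ℝ}

lemma inner_sqrtC₁_left (x y : X) : ⟪S.sqrtC₁ x, y⟫ = ⟪x, S.sqrtC₁ y⟫ :=
  S.sqrtC₁_pos.1 x y

lemma inner_C₁_left (x y : X) : ⟪S.C₁ x, y⟫ = ⟪S.sqrtC₁ x, S.sqrtC₁ y⟫ := by
  rw [← S.sqrtC₁_sq, inner_sqrtC₁_left]

lemma sqrtC₁_injective : Function.Injective S.sqrtC₁ := by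
  refine (injective_iff_map_eq_zero S.sqrtC₁).2 fun x hx => ?_
  by_contra h
  exact (S.C₁_posDef.2 x h).ne' (by rw [inner_C₁_left, hx, inner_zero_left])

lemma sqrtC₁_invSqrtC₁ {x : X} (hx : x ∈ S.domInvSqrtC₁) : S.sqrtC₁ (S.invSqrtC₁ x) = x :=
  Function.invFun_eq hx

lemma invSqrtC₁_sqrtC₁ (x : X) : S.invSqrtC₁ (S.sqrtC₁ x) = x :=
  Function.leftInverse_invFun sqrtC₁_injective x

lemma inner_invSqrtC₁_left {x y : X} (hx : x ∈ S.domInvSqrtC₁) (hy : y ∈ S.domInvSqrtC₁) :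
    ⟪S.invSqrtC₁ x, y⟫ = ⟪x, S.invSqrtC₁ y⟫ := by
  obtain ⟨x, rfl⟩ := hx
  obtain ⟨y, rfl⟩ := hy
  rw [invSqrtC₁_sqrtC₁, invSqrtC₁_sqrtC₁, inner_sqrtC₁_left]

lemma inner_Ainv_left (x y : X) : ⟪S.Ainv x, y⟫ = ⟪x, S.Ainv y⟫ := by
  obtain ⟨hx, hAx⟩ := (S.Ainv_spec x (S.Ainv x)).1 rfl
  obtain ⟨hy, hAy⟩ := (S.Ainv_spec y (S.Ainv y)).1 rfl
  have hsymm := LinearPMap.adjoint_isFormalAdjoint S.A_selfAdjoint.dense_domain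
  rw [LinearPMap.isSelfAdjoint_def.1 S.A_selfAdjoint] at hsymm
  simpa only [hAx, hAy] using (hsymm ⟨S.Ainv x, hx⟩ ⟨S.Ainv y, hy⟩).symm

section Extension

variable {E F : Type*} [NormedAddCommGroup E] [NormedSpace ℝ E] [NormedAddCommGroup F]
  [NormedSpace ℝ F] {t c : ℝ}

lemma isBoundedOn_comp {K : E →L[ℝ] F} {M : E →L[ℝ] X} (hM : Function.Injective M)
    {G : X →L[ℝ] X} {T : X → E} (hT : ∀ u ∈ S.smooth, M (T u) = G u)
    (hbound : ∀ u ∈ S.smooth, ‖K (T u)‖ ≤ c * S.scaleNorm t (S.coeff u)) :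
    S.IsBoundedOn t c fun u => K (T u) where
  map_sub u hu v hv := by
    rw [← map_sub]
    exact congrArg K (hM (by rw [hT _ (sub_mem_smooth hu hv), map_sub, map_sub, hT u hu, hT v hv]))
  map_trunc a s := by
    simp only [← map_smul, ← map_sum]
    refine congrArg K (hM ?_)
    rw [hT _ (trunc_mem_smooth a s), trunc, map_sum, map_sum]
    exact Finset.sum_congr rfl fun i _ => by rw [map_smul, map_smul, hT _ (basis_mem_smooth i)]
  bound := hbound

lemma exists_map_eq_of_bound [CompleteSpace E] {M : E →L[ℝ] X} (hM : Function.Injective M)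
    {G : X →L[ℝ] X} {T : X → E} (hT : ∀ u ∈ S.smooth, M (T u) = G u)
    (hbound : ∀ u ∈ S.smooth, ‖T u‖ ≤ c * S.scaleNorm t (S.coeff u)) {w : X}
    (hw : S.MemScale t (S.coeff w)) : ∃ z, M z = G w := by
  have hbdd : S.IsBoundedOn t c T :=
    isBoundedOn_comp (K := ContinuousLinearMap.id ℝ E) hM hT hbound
  obtain ⟨z, hz⟩ := hbdd.summable_smul hw
  refine ⟨z, (M.hasSum hz).unique ?_⟩
  convert G.hasSum (hasSum_inner_basis_smul S.φ w) using 2 with i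
  rw [map_smul, map_smul, hT _ (basis_mem_smooth i), coeff]

end Extension

namespace Assumptions

variable (hS : S.Assumptions s₀ β ℓ c₁ c₂ c₃ c₄)
include hS

lemma sqrtC₁_invSqrtC₁_Ainv {u : X} (hu : u ∈ S.smooth) :
    S.sqrtC₁ (S.invSqrtC₁ (S.Ainv u)) = S.Ainv u := sqrtC₁_invSqrtC₁ (hS.equiv.1 u hu)

lemma Ainv_mem {w : X} (hw : S.MemScale 1 (S.coeff w)) : S.Ainv w ∈ S.domInvSqrtC₁ := by
  obtain ⟨-, c, _, hc, -, h⟩ := hS.equiv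
  refine exists_map_eq_of_bound (t := β - 2 * ℓ) (c := c⁻¹) sqrtC₁_injective
    (fun u hu => hS.sqrtC₁_invSqrtC₁_Ainv hu) (fun u hu => ?_)
    (hw.of_le (by linarith [hS.delta, hS.s₀_nonneg]))
  rw [← div_eq_inv_mul, le_div_iff₀' hc]
  exact (h u hu).1

end Assumptions

variable (S) in
/-- `L = C₁^(-1/2) A⁻¹ C₀^(1/2)`, the forward operator between the whitened unknown `C₀^(-1/2) u`
and the whitened data `C₁^(-1/2) y`. -/
def IsForward (L : X →L[ℝ] X) : Prop := ∀ h, S.sqrtC₁ (L h) = S.Ainv (S.sqrtC₀ h)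

lemma Assumptions.exists_isForward (hS : S.Assumptions s₀ β ℓ c₁ c₂ c₃ c₄) :
    ∃ L, S.IsForward L := by
  choose L hL using fun h =>
    show ∃ z, S.sqrtC₁ z = S.Ainv (S.sqrtC₀ h) from
      hS.Ainv_mem ((memScale_coeff_iff zero_le_one).2 ⟨h, rfl⟩)
  let L' : X →ₗ[ℝ] X :=
    { toFun := L
      map_add' := fun x y => sqrtC₁_injective (S := S) (by simp only [hL, map_add])
      map_smul' := fun c x => sqrtC₁_injective (S := S) (by
        simp only [hL, map_smul, RingHom.id_apply]) }
  have hclosed : ∀ (u : ℕ → X) (x y : X), Tendsto u atTop (𝓝 x) →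
      Tendsto (L' ∘ u) atTop (𝓝 y) → y = L' x := fun u x y hu hy => by
    refine sqrtC₁_injective (S := S) (Eq.trans ?_ (hL x).symm)
    exact tendsto_nhds_unique ((S.sqrtC₁.continuous.tendsto y).comp hy)
      ((((S.Ainv ∘L S.sqrtC₀).continuous.tendsto x).comp hu).congr fun j => (hL (u j)).symm)
  exact ⟨⟨L', L'.continuous_of_seq_closed_graph hclosed⟩, hL⟩

variable (S) in
/-- The element `C₀^(1/2) A⁻¹ C₁⁻¹ p` of `X`, for `p` in the domain of `C₁^(-1/2)`. -/
noncomputable def pullback (L : X →L[ℝ] X) (p : X) : X := adjoint L (S.invSqrtC₁ p)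

lemma inner_pullback (L : X →L[ℝ] X) (p h : X) : ⟪S.pullback L p, h⟫ = ⟪S.invSqrtC₁ p, L h⟫ :=
  ContinuousLinearMap.adjoint_inner_left ..

variable (S) in
/-- The covariance operator `n⁻¹ C₀^(1/2) (L* L + lam)⁻¹ C₀^(1/2)` of the posterior. -/
noncomputable def posteriorCov (L : X →L[ℝ] X) (n lam : ℝ) : X →L[ℝ] X :=
  n⁻¹ • (S.sqrtC₀ ∘L tikhonovInv L lam ∘L S.sqrtC₀)

lemma posteriorCov_apply (L : X →L[ℝ] X) (n lam : ℝ) (x : X) :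
    S.posteriorCov L n lam x = n⁻¹ • S.sqrtC₀ (tikhonovInv L lam (S.sqrtC₀ x)) := rfl

lemma inner_posteriorCov_left (L : X →L[ℝ] X) (n lam : ℝ) (x y : X) :
    ⟪S.posteriorCov L n lam x, y⟫ = n⁻¹ * ⟪tikhonovInv L lam (S.sqrtC₀ x), S.sqrtC₀ y⟫ := by
  rw [posteriorCov_apply, real_inner_smul_left, inner_potential_left]

lemma posDef_posteriorCov (L : X →L[ℝ] X) {n lam : ℝ} (hn : 0 < n) (hlam : 0 < lam) :
    PositiveDefinite (S.posteriorCov L n lam) := by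
  have hR := posDef_tikhonovInv L hlam
  refine ⟨fun x y => ?_, fun x hx => ?_⟩
  · rw [inner_posteriorCov_left, real_inner_comm _ x, inner_posteriorCov_left, hR.1,
      real_inner_comm]
  · rw [inner_posteriorCov_left]
    refine mul_pos (inv_pos.2 hn) (hR.2 _ fun h => hx ?_)
    exact potential_injective (h.trans (map_zero _).symm)

namespace IsForward

variable {L : X →L[ℝ] X} (hL : S.IsForward L)
include hL

lemma invSqrtC₁_Ainv_sqrtC₀ (h : X) : S.invSqrtC₁ (S.Ainv (S.sqrtC₀ h)) = L h := by
  rw [← hL, invSqrtC₁_sqrtC₁]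

lemma adjoint_sqrtC₁ (e : X) : adjoint L (S.sqrtC₁ e) = S.sqrtC₀ (S.Ainv e) := by
  refine ext_inner_right ℝ fun x => ?_
  rw [ContinuousLinearMap.adjoint_inner_left, inner_sqrtC₁_left, hL, inner_potential_left,
    inner_Ainv_left]

end IsForward

section WeakSolution

variable {L : X →L[ℝ] X}

lemma Assumptions.represents_pullback (hS : S.Assumptions s₀ β ℓ c₁ c₂ c₃ c₄)
    (hL : S.IsForward L) (p : X) : S.Represents (-1) (S.AinvC₁inv p) (S.pullback L p) := by
  intro k
  have hLφ : L (S.φ k) = S.κ k ^ (1 / 2 : ℝ) • S.invSqrtC₁ (S.Ainv (S.φ k)) := by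
    refine sqrtC₁_injective (S := S) ?_
    rw [hL, potential_basis, map_smul, map_smul, hS.sqrtC₁_invSqrtC₁_Ainv (basis_mem_smooth k)]
  rw [pullback, ContinuousLinearMap.adjoint_inner_right, hLφ, real_inner_smul_left, neg_neg,
    real_inner_comm, AinvC₁inv]

lemma IsForward.B_sqrtC₀ (hL : S.IsForward L) (lam : ℝ) (h g : X) :
    S.B lam (S.sqrtC₀ h) (S.sqrtC₀ g) = ⟪tikhonov L lam h, g⟫ := by
  rw [B, hL.invSqrtC₁_Ainv_sqrtC₀, hL.invSqrtC₁_Ainv_sqrtC₀, inner_tikhonov_left,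
    ← S.φ.tsum_inner_mul_inner h g]
  congr 2
  refine tsum_congr fun k => ?_
  have hκ : (S.κ k)⁻¹ * (S.κ k ^ (1 / 2 : ℝ) * S.κ k ^ (1 / 2 : ℝ)) = 1 := by
    rw [← Real.rpow_add (κ_pos k), add_halves, Real.rpow_one, inv_mul_cancel₀ (κ_pos k).ne']
  rw [coeff, coeff, inner_basis_potential, inner_basis_potential, real_inner_comm h]
  linear_combination ⟪h, S.φ k⟫ * ⟪S.φ k, g⟫ * hκ

lemma IsForward.isWeakSolution_iff (hL : S.IsForward L) {lam : ℝ} (hlam : 0 < lam) {r : ℕ → ℝ}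
    {q : X} (hq : S.Represents (-1) r q) (w : X) :
    S.IsWeakSolution lam r w ↔ w = S.sqrtC₀ (tikhonovInv L lam q) := by
  have hrhs (g : X) : ∑' k, r k * S.coeff (S.sqrtC₀ g) k = ⟪q, g⟫ :=
    (hq.inner_eq_tsum (represents_potential g)).symm
  constructor
  · rintro ⟨hw, h⟩
    obtain ⟨x, rfl⟩ := (memScale_coeff_iff zero_le_one).1 hw
    have hx : tikhonov L lam x = q := ext_inner_right ℝ fun g => by
      rw [← hL.B_sqrtC₀, h _ ((memScale_coeff_iff zero_le_one).2 ⟨g, rfl⟩), hrhs]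
    rw [← hx, tikhonovInv_tikhonov L hlam]
  · rintro rfl
    refine ⟨(memScale_coeff_iff zero_le_one).2 ⟨_, rfl⟩, fun v hv => ?_⟩
    obtain ⟨g, rfl⟩ := (memScale_coeff_iff zero_le_one).1 hv
    rw [hL.B_sqrtC₀, tikhonov_tikhonovInv L hlam, hrhs]

lemma Assumptions.represents_precision (hS : S.Assumptions s₀ β ℓ c₁ c₂ c₃ c₄)
    (hL : S.IsForward L) {n τ : ℝ} (hn : n ≠ 0) (hτ : τ ≠ 0) (h : X) :
    S.Represents (-1) (S.precision n τ (S.sqrtC₀ h))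
      (n • tikhonov L (1 / (n * τ ^ 2)) h) := by
  intro k
  have hpull := hS.represents_pullback hL (S.Ainv (S.sqrtC₀ h)) k
  rw [pullback, hL.invSqrtC₁_Ainv_sqrtC₀, neg_neg] at hpull
  have hκ : S.κ k ^ (1 / 2 : ℝ) * S.κ k ^ (1 / 2 : ℝ) = S.κ k := by
    rw [← Real.rpow_add (κ_pos k), add_halves, Real.rpow_one]
  rw [inner_smul_right, tikhonov_apply, inner_add_right, hpull, inner_smul_right, precision, coeff,
    inner_basis_potential, neg_neg]
  have := κ_pos (S := S) k
  field_simp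
  linear_combination -⟪S.φ k, h⟫ * hκ

lemma Assumptions.hasPrecision (hS : S.Assumptions s₀ β ℓ c₁ c₂ c₃ c₄) (hL : S.IsForward L)
    {n τ : ℝ} (hn : 0 < n) (hτ : 0 < τ) :
    S.HasPrecision n τ (S.posteriorCov L n (1 / (n * τ ^ 2))) := by
  have hlam : 0 < 1 / (n * τ ^ 2) := by positivity
  intro x w
  have hx := represents_neg_potential (S := S) (ht := zero_le_one) x
  constructor
  · rintro rfl
    have hw := hS.represents_precision hL hn.ne' hτ.ne'
      (n⁻¹ • tikhonovInv L (1 / (n * τ ^ 2)) (S.sqrtC₀ x))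
    rw [map_smul, map_smul, tikhonov_tikhonovInv L hlam, smul_inv_smul₀ hn.ne'] at hw
    exact ⟨(memScale_coeff_iff zero_le_one).2 ⟨_, map_smul ..⟩, hw.unique_seq hx⟩
  · rintro ⟨hw, hprec⟩
    obtain ⟨h, rfl⟩ := (memScale_coeff_iff zero_le_one).1 hw
    have hsqrt := hx.unique (hprec ▸ hS.represents_precision hL hn.ne' hτ.ne' h)
    rw [posteriorCov_apply, hsqrt, map_smul, map_smul, tikhonovInv_tikhonov L hlam,
      inv_smul_smul₀ hn.ne']

end WeakSolution

namespace Assumptions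

variable (hS : S.Assumptions s₀ β ℓ c₁ c₂ c₃ c₄)
include hS

lemma exists_smoothing_exponent :
    ∃ s, s₀ < s ∧ s ≤ 1 ∧ s + β - 2 * ℓ ≤ 1 ∧ (⌈β - s₀ - 1⌉ : ℝ) ≤ β - s := by
  have hceil := Int.ceil_lt_add_one (β - s₀ - 1)
  refine ⟨min 1 (min (2 * ℓ - β + 1) (β - ⌈β - s₀ - 1⌉)), ?_, min_le_left .., ?_, ?_⟩
  · exact lt_min hS.s₀_lt_one (lt_min (by linarith [hS.delta, hS.s₀_nonneg]) (by linarith))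
  · linarith [min_le_right 1 (min (2 * ℓ - β + 1) (β - ⌈β - s₀ - 1⌉)),
      min_le_left (2 * ℓ - β + 1) (β - ⌈β - s₀ - 1⌉)]
  · linarith [min_le_right 1 (min (2 * ℓ - β + 1) (β - ⌈β - s₀ - 1⌉)),
      min_le_right (2 * ℓ - β + 1) (β - ⌈β - s₀ - 1⌉)]

lemma summable_mul_norm_sqrtC₁_sq :
    Summable fun k => S.κ k ^ (-(2 * β - 2 * ℓ - 1)) * ‖S.sqrtC₁ (S.φ k)‖ ^ 2 := by
  set ρ : ℝ := max (2 * β - 2 * ℓ - 1) ⌈β - s₀ - 1⌉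
  have hρβ : ρ < β - s₀ := max_lt (by linarith [hS.delta, hS.s₀_nonneg])
    (by linarith [Int.ceil_lt_add_one (β - s₀ - 1)])
  have hbound (j : ℕ) := hS.sqrtC₁_bound ρ (le_max_right ..) hρβ _ (basis_mem_smooth j)
  have hrow (j : ℕ) :
      ∑' i, S.κ i ^ (-ρ) * ⟪S.φ i, S.sqrtC₁ (S.φ j)⟫ ^ 2 ≤ c₁ ^ 2 * S.κ j ^ (β - ρ) := by
    rw [show β - ρ = -(ρ - β) by ring, ← scaleNorm_basis_sq, ← mul_pow]
    exact (scaleNorm_sq _ _).symm.trans_le (pow_le_pow_left₀ (scaleNorm_nonneg _ _) (hbound j).2 2)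
  refine summable_rpow_mul_of_le (t' := ρ) (le_max_left ..) (fun _ => sq_nonneg _) ?_
  refine summable_mul_norm_sq_of_isSymmetric S.φ inner_sqrtC₁_left (fun _ => (κ_rpow_pos _ _).le)
    (fun j => (hbound j).1) (Summable.of_nonneg_of_le (fun j => ?_) hrow ?_)
  · exact tsum_nonneg fun i => mul_nonneg (κ_rpow_pos _ i).le (sq_nonneg _)
  · exact (hS.trace _ (by linarith)).mul_left _

section Forward

variable {L : X →L[ℝ] X} (hL : S.IsForward L)
include hL

lemma isBoundedOn_pullback : S.IsBoundedOn (2 * β - 2 * ℓ - 1) c₄ (S.pullback L) :=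
  isBoundedOn_comp (K := adjoint L) (G := ContinuousLinearMap.id ℝ X) sqrtC₁_injective
    (fun u hu => sqrtC₁_invSqrtC₁ (hS.invSqrtC₁_bound.1 u hu)) fun u hu => by
      have h := (hS.AinvC₁inv_bound 1 (by linarith [hS.delta, hS.s₀_nonneg]) le_rfl u hu).2
      rwa [(hS.represents_pullback hL u).scaleNorm_eq] at h

lemma isAinvC₁inv_iff {y r : ℕ → ℝ} {q : X} (hy : S.MemScale (2 * β - 2 * ℓ - 1) y)
    (hq : HasSum (fun i => y i • S.pullback L (S.φ i)) q) (hr : S.Represents (-1) r q)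
    (r' : ℕ → ℝ) : S.IsAinvC₁inv (2 * β - 2 * ℓ - 1) y r' ↔ r' = r := by
  have hT := hS.isBoundedOn_pullback hL
  have hnorm {r' : ℕ → ℝ} {q' : X} (hr' : S.Represents (-1) r' q') (u : X) :
      S.scaleNorm (-1) (S.AinvC₁inv u - r') = ‖S.pullback L u - q'‖ :=
    ((hS.represents_pullback hL u).sub hr').scaleNorm_eq
  constructor
  · rintro ⟨-, hmem, u, hu, hlim, hlim'⟩
    obtain ⟨q', hr'⟩ := hmem.exists_represents
    simp only [hnorm hr', ← tendsto_iff_norm_sub_tendsto_zero] at hlim'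
    exact hr'.unique_seq (tendsto_nhds_unique hlim' (hT.tendsto_of_hasSum hy hq hu hlim) ▸ hr)
  · rintro rfl
    have hu (j : ℕ) : S.trunc y (Finset.range j) ∈ S.smooth := trunc_mem_smooth _ _
    refine ⟨hy, hr.memScale, _, hu, hy.tendsto_trunc, ?_⟩
    simp only [hnorm hr, ← tendsto_iff_norm_sub_tendsto_zero]
    exact hT.tendsto_of_hasSum hy hq hu hy.tendsto_trunc

lemma summable_inner_pullback_sq (h : X) :
    Summable fun i => S.κ i ^ (2 * β - 2 * ℓ - 1) * ⟪S.pullback L (S.φ i), h⟫ ^ 2 := by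
  have hT := hS.isBoundedOn_pullback hL
  generalize 2 * β - 2 * ℓ - 1 = a at hT ⊢
  have hBessel := summable_inner_sq_of_norm_sum_sq_le
    (f := fun i => S.κ i ^ (a / 2) • S.pullback L (S.φ i)) (c := c₄ ^ 2) (fun b F => ?_) h
  · simpa only [real_inner_smul_left, κ_rpow_half_mul_sq] using hBessel
  · simpa only [κ_rpow_half_mul_sq, ← mul_assoc, ← Real.rpow_add (κ_pos _), neg_add_cancel,
      Real.rpow_zero, one_mul, smul_smul, mul_comm (b _)] using
      hT.norm_sum_smul_sq_le (fun i => S.κ i ^ (a / 2) * b i) F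

lemma exists_potential_eq_forward {s : ℝ} (hs : 0 ≤ s) (hs₀ : s₀ < s) (hs₁ : s ≤ 1)
    (hsΔ : s + β - 2 * ℓ ≤ 1) (h : X) : ∃ g, S.potential hs g = L h := by
  have hbound := hS.invSqrtC₁_Ainv_bound s hs₀ hs₁
  choose! T hT using fun u hu => (memScale_coeff_iff hs).1 (hbound u hu).1
  have hw : S.MemScale 1 (S.coeff (S.sqrtC₀ h)) := (represents_potential h).memScale
  obtain ⟨g, hg⟩ := exists_map_eq_of_bound (M := S.sqrtC₁ ∘L S.potential hs) (G := S.Ainv) (T := T)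
    (sqrtC₁_injective.comp potential_injective)
    (fun u hu => (congrArg S.sqrtC₁ (hT u hu)).trans (hS.sqrtC₁_invSqrtC₁_Ainv hu))
    (fun u hu => by
      rw [← (represents_potential (ht := hs) (T u)).scaleNorm_eq, hT u hu]
      exact (hbound u hu).2)
    (hw.of_le hsΔ)
  exact ⟨g, sqrtC₁_injective (S := S) (hg.trans (hL h).symm)⟩

end Forward

lemma isBoundedOn_potential_invSqrtC₁ {s : ℝ} (hs : 0 ≤ s) (hs₀ : s₀ < s) (hs₁ : s ≤ 1) :
    S.IsBoundedOn (β - s) c₂ fun u => S.potential hs (S.invSqrtC₁ u) :=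
  isBoundedOn_comp (G := ContinuousLinearMap.id ℝ X) sqrtC₁_injective
    (fun u hu => sqrtC₁_invSqrtC₁ (hS.invSqrtC₁_bound.1 u hu)) fun u hu => by
      rw [← (represents_neg_potential _).scaleNorm_eq]
      exact hS.invSqrtC₁_bound.2 s hs₀ hs₁ u hu

lemma basis_mem_domInvSqrtC₁ (k : ℕ) : S.φ k ∈ S.domInvSqrtC₁ :=
  hS.invSqrtC₁_bound.1 _ (basis_mem_smooth k)

lemma hasSum_potential_invSqrtC₁ {s : ℝ} (hs : 0 ≤ s) (hs₀ : s₀ < s) (hs₁ : s ≤ 1) {e : X}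
    (he : S.MemScale (β - s) (S.coeff (S.sqrtC₁ e))) :
    HasSum (fun i => ⟪S.φ i, S.sqrtC₁ e⟫ • S.potential hs (S.invSqrtC₁ (S.φ i)))
      (S.potential hs e) := by
  obtain ⟨z, hz⟩ := (hS.isBoundedOn_potential_invSqrtC₁ hs hs₀ hs₁).summable_smul he
  suffices h : S.potential hs e = z by rwa [h]
  refine eq_of_inner_basis_eq S.φ fun k => ?_
  have hcoeff : HasSum (fun i => S.κ k ^ (s / 2) * (⟪S.invSqrtC₁ (S.φ k), S.φ i⟫ *
      ⟪S.φ i, S.sqrtC₁ e⟫)) (S.κ k ^ (s / 2) * ⟪S.φ k, e⟫) := by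
    rw [← sqrtC₁_invSqrtC₁ (hS.basis_mem_domInvSqrtC₁ k), inner_sqrtC₁_left,
      sqrtC₁_invSqrtC₁ (hS.basis_mem_domInvSqrtC₁ k)]
    exact (S.φ.hasSum_inner_mul_inner _ _).mul_left _
  rw [inner_basis_potential]
  refine hcoeff.unique ((hz.mapL (innerSL ℝ (S.φ k))).congr_fun fun i => ?_)
  rw [innerSL_apply_apply, inner_smul_right, inner_basis_potential,
    inner_invSqrtC₁_left (hS.basis_mem_domInvSqrtC₁ k) (hS.basis_mem_domInvSqrtC₁ i), coeff]
  ring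

lemma hasSum_forward {L : X →L[ℝ] X} (hL : S.IsForward L) (h : X) :
    HasSum (fun i => ⟪S.pullback L (S.φ i), h⟫ • S.sqrtC₁ (S.φ i)) (L h) := by
  obtain ⟨s, hs₀, hs₁, hsΔ, hρ⟩ := hS.exists_smoothing_exponent
  have hs : 0 ≤ s := hS.s₀_nonneg.trans hs₀.le
  obtain ⟨g, hg⟩ := hS.exists_potential_eq_forward hL hs hs₀ hs₁ hsΔ h
  obtain ⟨z, hz⟩ := summable_smul_of_summable_sq (fun i => κ_rpow_pos (S := S) _ i)
    (hS.summable_inner_pullback_sq hL h)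
    (by simpa only [← Real.rpow_neg (κ_pos _).le] using hS.summable_mul_norm_sqrtC₁_sq)
  suffices hLz : L h = z by rwa [hLz]
  refine eq_of_inner_basis_eq S.φ fun k => ?_
  have hmem := (hS.sqrtC₁_bound (β - s) hρ (by linarith) _ (basis_mem_smooth k)).1
  have hsum := (hS.hasSum_potential_invSqrtC₁ hs hs₀ hs₁ hmem).mapL (innerSL ℝ g)
  rw [innerSL_apply_apply, real_inner_comm, inner_potential_left, hg] at hsum
  refine hsum.unique ((hz.mapL (innerSL ℝ (S.φ k))).congr_fun fun i => ?_)
  rw [innerSL_apply_apply, innerSL_apply_apply, inner_smul_right, inner_smul_right,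
    real_inner_comm _ g, inner_potential_left, hg, inner_pullback, ← inner_sqrtC₁_left,
    real_inner_comm (S.φ k)]
  ring

end Assumptions

end Setting

/-! ### The posterior -/

section JointVariance

variable {X Y : Type*} [NormedAddCommGroup X] [InnerProductSpace ℝ X] [CompleteSpace X]
  [NormedAddCommGroup Y] [InnerProductSpace ℝ Y] [CompleteSpace Y] (L : X →L[ℝ] Y)

/-- The variance of `⟪x, w⟫ + ⟪e, L w + n^(-1/2) η⟫` for a white noise `w` of variance `τ²` and an
independent white noise `η` of variance `1`. -/
noncomputable def jointVar (n τ : ℝ) (x : X) (e : Y) : ℝ :=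
  τ ^ 2 * ‖x + adjoint L e‖ ^ 2 + n⁻¹ * ‖e‖ ^ 2

lemma continuous_jointVar (n τ : ℝ) (x : X) : Continuous (jointVar L n τ x) := by
  unfold jointVar
  fun_prop

lemma jointVar_nonneg {n : ℝ} (hn : 0 ≤ n) (τ : ℝ) (x : X) (e : Y) : 0 ≤ jointVar L n τ x e := by
  unfold jointVar
  positivity

lemma jointVar_zero_zero (n τ : ℝ) : jointVar L n τ 0 0 = 0 := by simp [jointVar]

lemma jointVar_zero_left_le (n τ : ℝ) (e : Y) :
    jointVar L n τ 0 e ≤ (τ ^ 2 * ‖adjoint L‖ ^ 2 + n⁻¹) * ‖e‖ ^ 2 := by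
  rw [jointVar, zero_add, add_mul, mul_assoc, ← mul_pow ‖adjoint L‖]
  gcongr
  exact (adjoint L).le_opNorm e

/-- Subtracting the best linear predictor `L (L* L + lam)⁻¹ x` removes the correlations. -/
lemma jointVar_sub {n τ : ℝ} (hn : 0 < n) (hτ : 0 < τ) (x : X) (e : Y) :
    jointVar L n τ x (e - L (tikhonovInv L (1 / (n * τ ^ 2)) x)) =
      n⁻¹ * ⟪tikhonovInv L (1 / (n * τ ^ 2)) x, x⟫ + jointVar L n τ 0 e := by
  set lam := 1 / (n * τ ^ 2) with hlam
  have hlam_pos : 0 < lam := by positivity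
  have hτlam : τ ^ 2 * lam = n⁻¹ := by
    rw [hlam]
    field_simp
  rw [inner_tikhonovInv_left L hlam_pos]
  set g := tikhonovInv L lam x
  have hx : x + adjoint L (e - L g) = lam • g + adjoint L e := by
    nth_rw 1 [← tikhonov_tikhonovInv L hlam_pos x, tikhonov_apply, map_sub]
    abel
  rw [jointVar, jointVar, hx, zero_add, norm_add_sq_real, norm_sub_sq_real, norm_smul, mul_pow,
    Real.norm_eq_abs, sq_abs, real_inner_smul_left, ContinuousLinearMap.adjoint_inner_right,
    real_inner_comm (L g) e, real_inner_self_eq_norm_sq, real_inner_self_eq_norm_sq]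
  linear_combination (lam * ‖g‖ ^ 2 + 2 * ⟪L g, e⟫) * hτlam

end JointVariance

namespace Setting

variable {X : Type*} [NormedAddCommGroup X] [InnerProductSpace ℝ X] [CompleteSpace X]

lemma linearCombination_data (S : Setting X) (n : ℝ) {Ω : Type*} (u : Ω → X)
    (ξ : Ω → ℕ → ℝ) (b : ℕ →₀ ℝ) (ω : Ω) :
    Finsupp.linearCombination ℝ (S.data n u ξ ω) b =
      ⟪S.Ainv (Finsupp.linearCombination ℝ S.φ b), u ω⟫ +
        Finsupp.linearCombination ℝ (ξ ω) ((√n)⁻¹ • b) := by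
  simp only [map_smul, Finsupp.linearCombination_apply, Finsupp.sum, data, coeff, inner_Ainv_left,
    sum_inner, real_inner_smul_left, smul_eq_mul, Finset.mul_sum, mul_add, Finset.sum_add_distrib]
  congr 1
  exact Finset.sum_congr rfl fun i _ => mul_left_comm ..

lemma IsNoiseLaw.hasLaw_linearCombination {S : Setting X} {ν : Measure (ℕ → ℝ)}
    (hν : S.IsNoiseLaw ν) (b : ℕ →₀ ℝ) : HasLaw (fun a => Finsupp.linearCombination ℝ a b)
      (gaussianReal 0 (‖S.sqrtC₁ (Finsupp.linearCombination ℝ S.φ b)‖ ^ 2).toNNReal) ν := by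
  obtain ⟨hgauss, hmean, hcov⟩ := hν
  let Λ : StrongDual ℝ (ℕ → ℝ) := ∑ i ∈ b.support, b i • ContinuousLinearMap.proj i
  have hΛ : ⇑Λ = fun a => ∑ i ∈ b.support, b i * a i := funext fun a => by simp [Λ]
  have hmem (i : ℕ) : MemLp (fun a : ℕ → ℝ => a i) 2 ν :=
    memLp_continuousLinear_of_isGaussian (E := ℕ → ℝ) (.proj i)
  have hΛ_mean : ∫ a, Λ a ∂ν = 0 := by
    simp only [hΛ]
    rw [integral_finsetSum _ fun i _ => ((hmem i).integrable (by norm_num)).const_mul _]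
    simp only [integral_const_mul, hmean, mul_zero, Finset.sum_const_zero]
  have hΛ_var : Var[Λ; ν] = ‖S.sqrtC₁ (Finsupp.linearCombination ℝ S.φ b)‖ ^ 2 := by
    rw [← real_inner_self_eq_norm_sq, ← inner_C₁_left, ← covariance_self (by fun_prop), hΛ,
      covariance_fun_sum_fun_sum' (fun i _ => (hmem i).const_mul _)
        (fun i _ => (hmem i).const_mul _), Finsupp.linearCombination_apply, Finsupp.sum]
    simp only [covariance_const_mul_left, covariance_const_mul_right, hcov, map_sum, map_smul,
      sum_inner, inner_sum, real_inner_smul_left, real_inner_smul_right]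
    exact Finset.sum_comm
  have hlaw := hgauss.map_eq_gaussianReal Λ
  rw [hΛ_mean, hΛ_var, hΛ] at hlaw
  exact ⟨Λ.continuous.aemeasurable.congr (.of_forall fun a => congrFun hΛ a), hlaw⟩

variable [MeasurableSpace X] [BorelSpace X]
  {S : Setting X} {s₀ β ℓ c₁ c₂ c₃ c₄ : ℝ} {n τ : ℝ}
  {Ω : Type*} [MeasurableSpace Ω] {P : Measure Ω} {u : Ω → X} {ξ : Ω → ℕ → ℝ}

variable (S) in
/-- The Bayesian model with prior `u ∼ N(0, τ² C₀)` and independent noise `ξ ∼ N(0, C₁)`, at the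
noise level `n^(-1/2)`. -/
structure IsBayesModel (n τ : ℝ) (P : Measure Ω) (u : Ω → X) (ξ : Ω → ℕ → ℝ) : Prop where
  n_pos : 0 < n
  τ_pos : 0 < τ
  measurable_u : Measurable u
  measurable_ξ : Measurable ξ
  prior : IsGaussianWith (P.map u) 0 (τ ^ 2 • S.C₀)
  noise : S.IsNoiseLaw (P.map ξ)
  indep : IndepFun u ξ P

namespace IsBayesModel

variable (hM : S.IsBayesModel n τ P u ξ)
include hM

lemma hasLaw_noise (b : ℕ →₀ ℝ) : HasLaw (fun ω => Finsupp.linearCombination ℝ (ξ ω) b)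
    (gaussianReal 0 (‖S.sqrtC₁ (Finsupp.linearCombination ℝ S.φ b)‖ ^ 2).toNNReal) P :=
  (hM.noise.hasLaw_linearCombination b).fun_comp ⟨hM.measurable_ξ.aemeasurable, rfl⟩

variable [SecondCountableTopology X]

lemma measurable_data : Measurable (S.data n u ξ) := by
  have := hM.measurable_u
  have := hM.measurable_ξ
  refine measurable_pi_lambda _ fun k => ?_
  unfold data coeff
  fun_prop

lemma hasLaw_inner_prior (x : X) :
    HasLaw (fun ω => ⟪x, u ω⟫) (gaussianReal 0 (τ ^ 2 * ‖S.sqrtC₀ x‖ ^ 2).toNNReal) P := by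
  have h := hM.prior.hasLaw_inner x
  rw [smul_apply, real_inner_smul_left, inner_C₀_self] at h
  exact h.fun_comp ⟨hM.measurable_u.aemeasurable, rfl⟩

variable {L : X →L[ℝ] X} (hL : S.IsForward L)
include hL

lemma hasLaw_joint (x : X) (b : ℕ →₀ ℝ) :
    HasLaw (fun ω => ⟪x, u ω⟫ + Finsupp.linearCombination ℝ (S.data n u ξ ω) b)
      (gaussianReal 0 (jointVar L n τ (S.sqrtC₀ x)
        (S.sqrtC₁ (Finsupp.linearCombination ℝ S.φ b))).toNNReal) P := by
  set e := Finsupp.linearCombination ℝ S.φ b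
  have hu := hM.hasLaw_inner_prior (x + S.Ainv e)
  have hξ := hM.hasLaw_noise ((√n)⁻¹ • b)
  have hind : IndepFun (fun ω => ⟪x + S.Ainv e, u ω⟫)
      (fun ω => Finsupp.linearCombination ℝ (ξ ω) ((√n)⁻¹ • b)) P := by
    refine hM.indep.comp (φ := fun z => ⟪x + S.Ainv e, z⟫)
      (ψ := fun a => Finsupp.linearCombination ℝ a ((√n)⁻¹ • b)) (by fun_prop) ?_
    simp only [Finsupp.linearCombination_apply, Finsupp.sum]
    fun_prop
  have hsum := hind.hasLaw_fun_add hu hξ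
  rw [gaussianReal_conv_gaussianReal, add_zero, ← Real.toNNReal_add (by positivity) (by positivity),
    map_smul, map_smul, norm_smul, mul_pow, Real.norm_eq_abs, sq_abs, inv_pow,
    Real.sq_sqrt hM.n_pos.le, map_add, ← hL.adjoint_sqrtC₁] at hsum
  exact hsum.congr (.of_forall fun ω => by
    simp only [linearCombination_data, inner_add_left, add_assoc, e])

lemma ae_memScale (hS : S.Assumptions s₀ β ℓ c₁ c₂ c₃ c₄) :
    ∀ᵐ y ∂(P.map (S.data n u ξ)), S.MemScale (2 * β - 2 * ℓ - 1) y := by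
  set a := 2 * β - 2 * ℓ - 1
  have hκ (k : ℕ) : 0 < S.κ k ^ (-a) := κ_rpow_pos _ _
  have hv (k : ℕ) : 0 ≤ jointVar L n τ 0 (S.sqrtC₁ (S.φ k)) := jointVar_nonneg L hM.n_pos.le ..
  have hlaw (k : ℕ) : HasLaw (fun y : ℕ → ℝ => y k)
      (gaussianReal 0 (jointVar L n τ 0 (S.sqrtC₁ (S.φ k))).toNNReal) (P.map (S.data n u ξ)) := by
    have h := (hM.hasLaw_joint hL 0 (Finsupp.single k 1)).map_eq
    simp only [inner_zero_left, Finsupp.linearCombination_single, one_smul, zero_add,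
      map_zero] at h
    exact ⟨(measurable_pi_apply k).aemeasurable, by
      rw [Measure.map_map (by fun_prop) hM.measurable_data, ← h]; rfl⟩
  have hsq (k : ℕ) := integral_sq_of_hasLaw_gaussianReal (hv k) (hlaw k)
  refine ae_summable_of_summable_integral (fun k => (hsq k).1.const_mul _)
    (fun k y => mul_nonneg (hκ k).le (sq_nonneg _)) ?_
  simp only [integral_const_mul, (hsq _).2]
  refine .of_nonneg_of_le (fun k => mul_nonneg (hκ k).le (hv k)) (fun k => ?_)
    (hS.summable_mul_norm_sqrtC₁_sq.mul_left (τ ^ 2 * ‖adjoint L‖ ^ 2 + n⁻¹))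
  rw [mul_left_comm]
  exact mul_le_mul_of_nonneg_left (jointVar_zero_left_le ..) (hκ k).le

lemma exists_measurable_hasSum_pullback (hS : S.Assumptions s₀ β ℓ c₁ c₂ c₃ c₄) :
    ∃ q : (ℕ → ℝ) → X, Measurable q ∧ ∀ᵐ y ∂(P.map (S.data n u ξ)),
      HasSum (fun i => y i • S.pullback L (S.φ i)) (q y) :=
  exists_measurable_ae_hasSum (fun i => by fun_prop) <| (hM.ae_memScale hL hS).mono
    fun _ hy => (hS.isBoundedOn_pullback hL).summable_smul hy

section Posterior

variable [IsProbabilityMeasure P] (hS : S.Assumptions s₀ β ℓ c₁ c₂ c₃ c₄) {q : (ℕ → ℝ) → X}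
  (hq : Measurable q)
  (hsum : ∀ᵐ y ∂(P.map (S.data n u ξ)), HasSum (fun i => y i • S.pullback L (S.φ i)) (q y))
include hS hq hsum

lemma hasLaw_error (v : X) (b : ℕ →₀ ℝ) :
    HasLaw (fun ω => ⟪v, u ω - S.sqrtC₀ (tikhonovInv L (1 / (n * τ ^ 2)) (q (S.data n u ξ ω)))⟫ +
        Finsupp.linearCombination ℝ (S.data n u ξ ω) b)
      (gaussianReal 0 (⟪S.posteriorCov L n (1 / (n * τ ^ 2)) v, v⟫ + jointVar L n τ 0
        (S.sqrtC₁ (Finsupp.linearCombination ℝ S.φ b))).toNNReal) P := by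
  have hn := hM.n_pos
  have hτ := hM.τ_pos
  have hu := hM.measurable_u
  have hdata := hM.measurable_data
  set lam := 1 / (n * τ ^ 2)
  have hlam_pos : 0 < lam := by positivity
  set g := tikhonovInv L lam (S.sqrtC₀ v)
  have hinner (p : X) : ⟪v, S.sqrtC₀ (tikhonovInv L lam p)⟫ = ⟪p, g⟫ := by
    rw [← inner_potential_left, ← (posDef_tikhonovInv L hlam_pos).1, real_inner_comm]
  let d : ℕ → ℕ →₀ ℝ := fun N =>
    b - ∑ i ∈ Finset.range N, Finsupp.single i ⟪S.pullback L (S.φ i), g⟫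
  have hvar : Tendsto (fun N => jointVar L n τ (S.sqrtC₀ v)
      (S.sqrtC₁ (Finsupp.linearCombination ℝ S.φ (d N)))) atTop
      (𝓝 (jointVar L n τ (S.sqrtC₀ v)
        (S.sqrtC₁ (Finsupp.linearCombination ℝ S.φ b) - L g))) := by
    refine ((continuous_jointVar L n τ _).tendsto _).comp ?_
    simpa only [d, map_sub, map_sum, Finsupp.linearCombination_single, map_smul] using
      (hS.hasSum_forward hL g).tendsto_sum_nat.const_sub _
  rw [jointVar_sub L hn hτ, ← inner_posteriorCov_left] at hvar
  refine hasLaw_gaussianReal_of_tendsto (fun N => hM.hasLaw_joint hL v (d N)) ?_ ?_ hvar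
  · simp only [Finsupp.linearCombination_apply, Finsupp.sum]
    fun_prop
  · filter_upwards [ae_of_ae_map hdata.aemeasurable hsum] with ω hω
    have hlim := ((hω.mapL (innerSL ℝ g)).tendsto_sum_nat.const_sub
      (Finsupp.linearCombination ℝ (S.data n u ξ ω) b)).const_add ⟪v, u ω⟫
    simp only [map_smul, innerSL_apply_apply, real_inner_comm _ g] at hlim
    simp only [d, inner_sub_right, hinner, map_sub, map_sum, Finsupp.linearCombination_single]
    simp only [smul_eq_mul, mul_comm (⟪_, g⟫)] at hlim ⊢
    rwa [sub_add_eq_add_sub, add_sub_assoc]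

lemma isGaussianWith_error :
    IsGaussianWith
      (P.map fun ω => u ω - S.sqrtC₀ (tikhonovInv L (1 / (n * τ ^ 2)) (q (S.data n u ξ ω)))) 0
      (S.posteriorCov L n (1 / (n * τ ^ 2))) := by
  have hn := hM.n_pos
  have hτ := hM.τ_pos
  have hu := hM.measurable_u
  have hdata := hM.measurable_data
  refine isGaussianWith_zero_of_hasLaw_inner (posDef_posteriorCov L hn (by positivity)) fun v => ?_
  have h := (hM.hasLaw_error hL hS hq hsum v 0).map_eq
  simp only [map_zero, add_zero, jointVar_zero_zero] at h
  refine ⟨by fun_prop, ?_⟩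
  rw [Measure.map_map (by fun_prop) (by fun_prop)]
  exact h

lemma indepFun_error_data : IndepFun
    (fun ω => u ω - S.sqrtC₀ (tikhonovInv L (1 / (n * τ ^ 2)) (q (S.data n u ξ ω))))
    (S.data n u ξ) P := by
  have hu := hM.measurable_u
  have hdata := hM.measurable_data
  have hlam : 0 < 1 / (n * τ ^ 2) := one_div_pos.2 (mul_pos hM.n_pos (pow_pos hM.τ_pos 2))
  refine indepFun_of_charFun_add (by fun_prop) hdata fun Λ b => ?_
  obtain ⟨v, rfl⟩ := (InnerProductSpace.toDual ℝ X).surjective Λ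
  simp only [InnerProductSpace.toDual_apply_apply]
  have hcov := (posDef_posteriorCov (S := S) L hM.n_pos hlam).inner_nonneg v
  have hvar := jointVar_nonneg L hM.n_pos.le τ 0 (S.sqrtC₁ (Finsupp.linearCombination ℝ S.φ b))
  have hdat := (hM.hasLaw_error hL hS hq hsum 0 b).map_eq
  have herr := (hM.hasLaw_error hL hS hq hsum v 0).map_eq
  simp only [inner_zero_left, map_zero, zero_add] at hdat
  simp only [map_zero, add_zero, jointVar_zero_zero] at herr
  rw [(hM.hasLaw_error hL hS hq hsum v b).map_eq, hdat, herr, charFun_gaussianReal,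
    charFun_gaussianReal, charFun_gaussianReal, Real.coe_toNNReal _ (add_nonneg hcov hvar),
    Real.coe_toNNReal _ hcov, Real.coe_toNNReal _ hvar, ← Complex.exp_add]
  push_cast
  ring_nf

lemma ae_isGaussianWith_condDistrib :
    ∀ᵐ y ∂(P.map (S.data n u ξ)), IsGaussianWith (condDistrib u (S.data n u ξ) P y)
      (S.sqrtC₀ (tikhonovInv L (1 / (n * τ ^ 2)) (q y)))
      (S.posteriorCov L n (1 / (n * τ ^ 2))) := by
  filter_upwards [condDistrib_ae_eq_map_const_add
    (m := fun y => S.sqrtC₀ (tikhonovInv L (1 / (n * τ ^ 2)) (q y))) hM.measurable_data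
    hM.measurable_u (by fun_prop) (hM.indepFun_error_data hL hS hq hsum)] with y hy
  rw [hy]
  exact (hM.isGaussianWith_error hL hS hq hsum).map_const_add _

end Posterior

end IsBayesModel

end Setting

end BayesInverse

theorem theorem2p1 {X : Type*} [NormedAddCommGroup X] [InnerProductSpace ℝ X] [CompleteSpace X]
    [TopologicalSpace.SeparableSpace X] [MeasurableSpace X] [BorelSpace X]
    (S : BayesInverse.Setting X)
    (s₀ β ℓ c₁ c₂ c₃ c₄ : ℝ) (hS : S.Assumptions s₀ β ℓ c₁ c₂ c₃ c₄)
    (n τ : ℝ) (hn : 0 < n) (hτ : 0 < τ)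
    {Ω : Type*} [MeasurableSpace Ω] (P : Measure Ω) [IsProbabilityMeasure P]
    (u : Ω → X) (ξ : Ω → ℕ → ℝ) (hu : Measurable u) (hξ : Measurable ξ)
    (hu_law : BayesInverse.IsGaussianWith (P.map u) 0 (τ ^ 2 • S.C₀))
    (hξ_law : S.IsNoiseLaw (P.map ξ)) (hind : IndepFun u ξ P) :
    -- `C₁^(-1/2) A⁻¹` is defined on all of `X^1`
    (∀ w : X, S.MemScale 1 (S.coeff w) → S.Ainv w ∈ S.domInvSqrtC₁) ∧
    ∃ C : X →L[ℝ] X, BayesInverse.PositiveDefinite C ∧ S.HasPrecision n τ C ∧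
      ∀ᵐ y ∂(P.map (S.data n u ξ)),
        -- `r = A⁻¹ C₁⁻¹ y` is well defined in `X^(-1)`
        ∃ r : ℕ → ℝ, (∀ r', S.IsAinvC₁inv (2 * β - 2 * ℓ - 1) y r' ↔ r' = r) ∧
          -- `m` is the unique weak solution of `B_lam m = r`, with `lam = 1 / (n τ²)`
          ∃ m : X, (∀ m', S.IsWeakSolution (1 / (n * τ ^ 2)) r m' ↔ m' = m) ∧
            -- the posterior, i.e. the conditional law of `u` given `y`, is `N(m, C)`
            BayesInverse.IsGaussianWith (condDistrib u (S.data n u ξ) P y) m C := by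
  have := UniformSpace.secondCountable_of_separable X
  have hM : S.IsBayesModel n τ P u ξ := ⟨hn, hτ, hu, hξ, hu_law, hξ_law, hind⟩
  have hlam : 0 < 1 / (n * τ ^ 2) := by positivity
  obtain ⟨L, hL⟩ := hS.exists_isForward
  obtain ⟨q, hq, hsum⟩ := hM.exists_measurable_hasSum_pullback hL hS
  refine ⟨fun w hw => hS.Ainv_mem hw, S.posteriorCov L n (1 / (n * τ ^ 2)),
    BayesInverse.Setting.posDef_posteriorCov L hn hlam, hS.hasPrecision hL hn hτ, ?_⟩
  filter_upwards [hM.ae_memScale hL hS, hsum, hM.ae_isGaussianWith_condDistrib hL hS hq hsum]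
    with y hy hqy hpost
  obtain ⟨r, hr⟩ := BayesInverse.Setting.exists_represents (S := S) (-1) (q y)
  exact ⟨r, hS.isAinvC₁inv_iff hL hy hqy hr, _, hL.isWeakSolution_iff hlam hr, hpost⟩
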